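/- Let $f\in C^\infty(\mathbb{R}^d,\mathbb{R}^d)$ and $y_0\in\mathbb{R}^d$. Let $T$ be the set of (unordered, unlabelled) finite rooted trees with at least one vertex, up to isomorphism of rooted trees. For $t\in T$ let $|t|$ be the number of vertices, $\tau$ the tree with one vertex, and $[t_1\cdots t_m]$ the tree obtained by joining the roots of $t_1,\dots,t_m$ to a new root. The symmetry is defined by $\sigma(\tau)=1$ and $\sigma([t_1^{k_1}\cdots t_m^{k_m}])=\prod_{i} k_i!\,\sigma(t_i)^{k_i}$ for distinct $t_1,\dots,t_m$. The elementary differentials $F(t):\mathbb{R}^d\to\mathbb{R}^d$ are defined by $F(\tau)=f$ and $F([t_1\cdots t_m])(y)=f^{(m)}(y)\big(F(t_1)(y),\dots,F(t_m)(y)\big)$. Write $t'\le t$ (or $t \ge t'$) if there is an injective map from the vertices of $t'$ to the vertices of $t$ that maps the root to the root and edges to edges. For $t'\le t$ let the pruning be $$t\setminus t'=\sum_{S} G(V(t)\setminus S),$$ where $S$ runs through the distinct images of such maps and $G(V(t)\setminus S)$ is the induced subgraph on the remaining vertices, regarded as a forest, i.e. a commutative product of rooted trees (each component being rooted at its vertex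 nearest to the root of $t$). So $t\setminus t'$ is a formal linear combination of forests. A map $a:\{\varnothing\}\cup T\to\mathbb{R}$ with $a(\varnothing)=1$ is extended to such combinations linearly and multiplicatively, with value $1$ on the empty forest. Let $$(B_h a)y_0=a(\varnothing)y_0+\sum_{t\in T}\frac{h^{|t|}a(t)}{\sigma(t)}F(t)(y_0),$$ a formal power series in $h$; a smooth map $g$ is evaluated at it by its Taylor series at $y_0$, $g(y_0+\delta)=\sum_{k\ge0}\frac1{k!}g^{(k)}(y_0)(\delta,\dots,\delta)$, expanded in powers of $h$. Then for every $a:\{\varnothing\}\cup T\to\mathbb{R}$ with $a(\varnothing)=1$ and every $t'\in T$, as formal power series in $h$, $$\frac{h^{|t'|}}{\sigma(t')}F(t')\big((B_h a)y_0\big)=\sum_{t\ge t'}\frac{h^{|t|}}{\sigma(t)}\,a(t\setminus t')\,F(t)(y_0).$$ -/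

import Mathlib

open scoped ContDiff

noncomputable section

namespace BSeries

/-- Plane (ordered) rooted trees: a root together with an ordered list of `n` branches. They serve
as concrete models of rooted trees; the unordered rooted trees are the classes `RTree` below. -/
inductive PTree : Type
  | node (n : ℕ) (c : Fin n → PTree) : PTree

namespace PTree

/-- The vertices of a plane tree: the root `none`, and the vertices `some ⟨i, v⟩` with `v` a vertex
of the `i`-th branch. -/
def Vert : PTree → Type
  | node _ c => Option (Σ i, Vert (c i))

/-- The root. -/
def root : (t : PTree) → Vert t
  | node _ _ => none

/-- `Edge t u v`: the tree has an edge that leads from `u` to `v` (away from the root). -/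
def Edge : (t : PTree) → Vert t → Vert t → Prop
  | node _ _, _, none => False
  | node _ c, none, some ⟨j, v⟩ => v = root (c j)
  | node _ c, some ⟨i, u⟩, some ⟨j, v⟩ => ∃ h : i = j, Edge (c j) (h ▸ u) v

/-- The full subtree of `t` that hangs from the vertex `v`: `v` and all its descendants. -/
def subtreeAt : (t : PTree) → Vert t → PTree
  | node n c, none => node n c
  | node _ c, some ⟨i, v⟩ => subtreeAt (c i) v

instance fintypeVert : (t : PTree) → Fintype (Vert t)
  | node _ c =>
    have : ∀ i, Fintype (Vert (c i)) := fun i => fintypeVert (c i)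
    inferInstanceAs (Fintype (Option (Σ i, Vert (c i))))

/-- The order: the number of vertices. -/
def order (t : PTree) : ℕ := Fintype.card (Vert t)

/-- Isomorphism of rooted trees: a bijection of the vertices that preserves the root and the
edges. -/
def Iso (s t : PTree) : Prop :=
  ∃ e : Vert s ≃ Vert t, e (root s) = root t ∧ ∀ u v, Edge s u v ↔ Edge t (e u) (e v)

instance setoid : Setoid PTree where
  r := Iso
  iseqv :=
    { refl := fun _ => ⟨Equiv.refl _, rfl, fun _ _ => Iff.rfl⟩
      symm := fun ⟨e, h, h'⟩ => ⟨e.symm, by rw [← h, e.symm_apply_apply], fun u v => by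
        rw [h', e.apply_symm_apply, e.apply_symm_apply]⟩
      trans := fun ⟨e, h, h'⟩ ⟨g, k, k'⟩ => ⟨e.trans g, by simp [h, k], fun u v => by
        rw [h', k']; rfl⟩ }

theorem Edge.not_root {t : PTree} {u : Vert t} : ¬ Edge t u (root t) := by
  cases t; cases u <;> exact id

theorem edge_root_iff {n : ℕ} {c : Fin n → PTree} (i : Fin n) (v : Vert (c i)) :
    Edge (node n c) none (some ⟨i, v⟩) ↔ v = root (c i) := Iff.rfl

theorem edge_some_iff {n : ℕ} {c : Fin n → PTree} (i : Fin n) (u v : Vert (c i)) :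
    Edge (node n c) (some ⟨i, u⟩) (some ⟨i, v⟩) ↔ Edge (c i) u v :=
  ⟨fun ⟨_, h⟩ => h, fun h => ⟨rfl, h⟩⟩

/-- Every vertex is reached from the root along edges. -/
theorem vert_induction : (t : PTree) → (P : Vert t → Prop) → P (root t) →
    (∀ u v, Edge t u v → P u → P v) → ∀ v, P v
  | node _ _, _, h0, _, none => h0
  | node _ c, P, h0, hs, some ⟨i, v⟩ =>
    vert_induction (c i) (fun v => P (some ⟨i, v⟩)) (hs none _ rfl h0)
      (fun _ _ h => hs _ _ ((edge_some_iff i _ _).2 h)) v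

/-- An isomorphism sends each branch into a branch. -/
theorem iso_branch {n m : ℕ} {c : Fin n → PTree} {d : Fin m → PTree}
    (e : Vert (node n c) ≃ Vert (node m d)) (h0 : e none = none)
    (h : ∀ u v, Edge (node n c) u v ↔ Edge (node m d) (e u) (e v)) (i : Fin n) :
    ∃ j, e (some ⟨i, root (c i)⟩) = some ⟨j, root (d j)⟩ ∧
      ∀ v, ∃ w, e (some ⟨i, v⟩) = some ⟨j, w⟩ := by
  have h1 : Edge (node m d) (e none) (e (some ⟨i, root (c i)⟩)) := (h _ _).1 rfl
  rw [h0] at h1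
  obtain ⟨j, hj⟩ : ∃ j, e (some ⟨i, root (c i)⟩) = some ⟨j, root (d j)⟩ := by
    rcases hx : e (some ⟨i, root (c i)⟩) with _ | ⟨j, w⟩
    · rw [hx] at h1; exact h1.elim
    · rw [hx] at h1
      have hw : w = root (d j) := h1
      exact ⟨j, by rw [hw]⟩
  refine ⟨j, hj, vert_induction _ _ ⟨_, hj⟩ ?_⟩
  rintro u v huv ⟨w, hw⟩
  have h2 := (h _ _).1 ((edge_some_iff i u v).2 huv)
  rw [hw] at h2
  rcases hx : e (some ⟨i, v⟩) with _ | ⟨k, x⟩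
  · rw [hx] at h2; exact h2.elim
  · rw [hx] at h2
    obtain ⟨rfl, -⟩ := h2
    exact ⟨x, rfl⟩

/-- An isomorphism permutes the branches and restricts to isomorphisms of them. -/
theorem iso_decomp {n m : ℕ} {c : Fin n → PTree} {d : Fin m → PTree}
    (e : Vert (node n c) ≃ Vert (node m d)) (h0 : e none = none)
    (h : ∀ u v, Edge (node n c) u v ↔ Edge (node m d) (e u) (e v)) :
    ∃ (ε : Fin n ≃ Fin m) (g : ∀ i, Vert (c i) ≃ Vert (d (ε i))),
      (∀ i, g i (root (c i)) = root (d (ε i)) ∧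
        ∀ u v, Edge (c i) u v ↔ Edge (d (ε i)) (g i u) (g i v)) ∧
      ∀ i v, e (some ⟨i, v⟩) = some ⟨ε i, g i v⟩ := by
  have h0' : e.symm none = none := by rw [← h0]; exact e.symm_apply_apply _
  have h' : ∀ u v, Edge (node m d) u v ↔ Edge (node n c) (e.symm u) (e.symm v) := fun u v => by
    rw [h, e.apply_symm_apply, e.apply_symm_apply]
  choose p hp q hq using iso_branch e h0 h
  choose p' hp' q' hq' using iso_branch e.symm h0' h'
  have l : ∀ i, p' (p i) = i := fun i => by
    have := e.symm_apply_apply (some ⟨i, root (c i)⟩)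
    rw [hp, hp'] at this
    exact congrArg Sigma.fst (Option.some.inj this)
  have r : ∀ j, p (p' j) = j := fun j => by
    have := e.apply_symm_apply (some ⟨j, root (d j)⟩)
    rw [hp', hp] at this
    exact congrArg Sigma.fst (Option.some.inj this)
  have bij : ∀ i, Function.Bijective (q i) := fun i => by
    constructor
    · intro u v huv
      have : e (some ⟨i, u⟩) = e (some ⟨i, v⟩) := by rw [hq, hq, huv]
      simpa using Option.some.inj (e.injective this)
    · intro w
      have hw := hq' (p i) w
      have hw2 : e (some ⟨p' (p i), q' (p i) w⟩) = some ⟨p i, w⟩ := by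
        rw [← hw]; exact e.apply_symm_apply _
      generalize q' (p i) w = x at hw2
      generalize hk : p' (p i) = k at x hw2
      obtain rfl : k = i := hk.symm.trans (l i)
      rw [hq] at hw2
      exact ⟨x, by simpa using Option.some.inj hw2⟩
  refine ⟨⟨p, p', l, r⟩, fun i => Equiv.ofBijective (q i) (bij i), fun i => ⟨?_, fun u v => ?_⟩,
    fun i v => hq i v⟩
  · have := (hq i (root (c i))).symm.trans (hp i)
    simpa using Option.some.inj this
  · have h2 := h (some ⟨i, u⟩) (some ⟨i, v⟩)
    rw [hq, hq] at h2
    exact (edge_some_iff i u v).symm.trans (h2.trans (edge_some_iff (c := d) (p i) _ _))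

theorem iso_node {n m : ℕ} {c : Fin n → PTree} {d : Fin m → PTree}
    (h : Iso (node n c) (node m d)) : ∃ ε : Fin n ≃ Fin m, ∀ i, Iso (c i) (d (ε i)) := by
  obtain ⟨e, h0, h⟩ := h
  obtain ⟨ε, g, hg, -⟩ := iso_decomp e h0 h
  exact ⟨ε, fun i => ⟨g i, hg i⟩⟩

theorem iso_subtreeAt : (s t : PTree) → (e : Vert s ≃ Vert t) → e (root s) = root t →
    (∀ u v, Edge s u v ↔ Edge t (e u) (e v)) → ∀ v, Iso (subtreeAt s v) (subtreeAt t (e v))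
  | node _ _, node _ _, e, h0, h, none => by
    have h0' : e none = none := h0
    rw [h0']
    exact ⟨e, h0, h⟩
  | node _ c, node _ d, e, h0, h, some ⟨i, v⟩ => by
    obtain ⟨ε, g, hg, hv⟩ := iso_decomp e h0 h
    rw [hv]
    exact iso_subtreeAt (c i) (d (ε i)) (g i) (hg i).1 (hg i).2 v

theorem Iso.order_eq {s t : PTree} (h : Iso s t) : order s = order t :=
  let ⟨e, _⟩ := h
  Fintype.card_congr e

theorem order_node (n : ℕ) (c : Fin n → PTree) : order (node n c) = 1 + ∑ i, order (c i) := by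
  have : order (node n c) = @Fintype.card (Option (Σ i, Vert (c i))) inferInstance :=
    Fintype.card_congr (Equiv.refl _)
  rw [this, Fintype.card_option, Fintype.card_sigma, add_comm]
  rfl

theorem finite_order_le : ∀ N : ℕ, {t : PTree | order t ≤ N}.Finite
  | 0 => by
    convert Set.finite_empty
    ext ⟨n, c⟩
    simp [order_node]
  | N + 1 => by
    have := (finite_order_le N).to_subtype
    refine (Set.finite_range (fun x : Σ k : Fin (N + 1), (Fin k → {t : PTree | order t ≤ N}) =>
      node x.1 fun i => (x.2 i).1)).subset ?_
    rintro ⟨n, c⟩ h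
    rw [Set.mem_ofPred_eq, order_node] at h
    have h1 : ∀ i, 1 ≤ order (c i) := fun i => by
      rcases c i with ⟨k, d⟩
      rw [order_node]; omega
    have h2 : n ≤ ∑ i, order (c i) := by
      simpa using Finset.sum_le_sum (s := Finset.univ) fun i _ => h1 i
    have h3 : ∀ i, order (c i) ≤ N := fun i => by
      have := Finset.single_le_sum (f := fun i => order (c i)) (fun _ _ => Nat.zero_le _)
        (Finset.mem_univ i)
      omega
    exact ⟨⟨⟨n, by omega⟩, fun i => ⟨c i, h3 i⟩⟩, rfl⟩

open Classical in
/-- The symmetry: `∏ kᵢ! σ(tᵢ)^kᵢ` for a tree with the distinct branches `tᵢ` of multiplicity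
`kᵢ`; the product of the `σ(tᵢ)^kᵢ` is written as a product over all branches. -/
def symmetry : PTree → ℕ
  | node _ c =>
    (∏ s ∈ Finset.univ.image (fun i => (⟦c i⟧ : Quotient setoid)),
      (Finset.univ.filter fun i => (⟦c i⟧ : Quotient setoid) = s).card.factorial) *
    ∏ i, symmetry (c i)

theorem Iso.symmetry_eq : (s t : PTree) → Iso s t → symmetry s = symmetry t
  | node _ c, node _ d, h => by
    classical
    obtain ⟨ε, hε⟩ := iso_node h
    have hq : ∀ i, (⟦c i⟧ : Quotient setoid) = ⟦d (ε i)⟧ := fun i => Quotient.sound (hε i)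
    rw [symmetry, symmetry]
    congr 1
    · have himg : Finset.univ.image (fun i => (⟦c i⟧ : Quotient setoid)) =
          Finset.univ.image (fun j => (⟦d j⟧ : Quotient setoid)) := by
        ext s
        simp only [Finset.mem_image, Finset.mem_univ, true_and, hq]
        exact ε.exists_congr_left.trans (by simp)
      rw [himg]
      refine Finset.prod_congr rfl fun s _ => congrArg _ ?_
      refine Finset.card_bij (fun i _ => ε i) ?_ (fun _ _ _ _ h => ε.injective h) ?_
      · intro i hi
        simpa [hq] using hi
      · intro j hj
        exact ⟨ε.symm j, by simpa [hq] using hj, by simp⟩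
    · rw [← ε.prod_comp]
      exact Finset.prod_congr rfl fun i _ => Iso.symmetry_eq _ _ (hε i)

section ElementaryDifferential

variable {E : Type*} [NormedAddCommGroup E] [NormedSpace ℝ E]

/-- The derivatives of a smooth map are symmetric: interchange of two neighbouring arguments. -/
theorem iteratedFDeriv_comp_swap {f : E → E} (hf : ContDiff ℝ ∞ f) : (n : ℕ) → (x : E) →
    (v : Fin (n + 1) → E) → (i : Fin n) →
    iteratedFDeriv ℝ (n + 1) f x (v ∘ Equiv.swap i.castSucc i.succ) =
      iteratedFDeriv ℝ (n + 1) f x v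
  | 0, _, _, i => i.elim0
  | n + 1, x, v, i => by
    induction i using Fin.cases with
    | zero =>
      have hd : ∀ y, DifferentiableAt ℝ (iteratedFDeriv ℝ (n + 1) f) y := fun y =>
        (hf.differentiable_iteratedFDeriv (by exact_mod_cast WithTop.coe_lt_top _)) y
      have hg : ContDiff ℝ 2 (iteratedFDeriv ℝ n f) := hf.iteratedFDeriv_right (by
        have h2 : ((2 + n : ℕ) : WithTop ℕ∞) ≤ ∞ :=
          WithTop.coe_le_coe.2 (le_top : ((2 + n : ℕ) : ℕ∞) ≤ ⊤)
        exact_mod_cast h2)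
      have hd' : DifferentiableAt ℝ (fderiv ℝ (iteratedFDeriv ℝ n f)) x :=
        (hg.fderiv_right (m := 1) le_rfl).differentiable one_ne_zero x
      have key : ∀ w : Fin (n + 2) → E, iteratedFDeriv ℝ (n + 2) f x w =
          fderiv ℝ (fderiv ℝ (iteratedFDeriv ℝ n f)) x (w 0) (w 1) (Fin.tail (Fin.tail w)) := by
        intro w
        rw [iteratedFDeriv_succ_apply_left]
        have e1 : HasFDerivAt (fun y => iteratedFDeriv ℝ (n + 1) f y (Fin.tail w))
            ((ContinuousMultilinearMap.apply ℝ (fun _ : Fin (n + 1) => E) E (Fin.tail w)).comp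
              (fderiv ℝ (iteratedFDeriv ℝ (n + 1) f) x)) x :=
          (ContinuousMultilinearMap.apply ℝ (fun _ : Fin (n + 1) => E) E
            (Fin.tail w)).hasFDerivAt.comp x (hd x).hasFDerivAt
        have e2 : HasFDerivAt (fun y => fderiv ℝ (iteratedFDeriv ℝ n f) y (w 1))
            ((ContinuousLinearMap.apply ℝ (E [×n]→L[ℝ] E) (w 1)).comp
              (fderiv ℝ (fderiv ℝ (iteratedFDeriv ℝ n f)) x)) x :=
          HasFDerivAt.comp x (g := ContinuousLinearMap.apply ℝ (E [×n]→L[ℝ] E) (w 1))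
            (ContinuousLinearMap.hasFDerivAt _) hd'.hasFDerivAt
        have e3 := (ContinuousMultilinearMap.apply ℝ (fun _ : Fin n => E) E
          (Fin.tail (Fin.tail w))).hasFDerivAt.comp x e2
        exact congrArg (fun L => L (w 0)) (e1.unique e3)
      have hsymm := hg.contDiffAt.isSymmSndFDerivAt (x := x) (by simp)
      rw [key, key]
      have h0 : (v ∘ Equiv.swap (0 : Fin (n + 1)).castSucc (0 : Fin (n + 1)).succ) 0 = v 1 := by
        simp
      have h1 : (v ∘ Equiv.swap (0 : Fin (n + 1)).castSucc (0 : Fin (n + 1)).succ) 1 = v 0 := by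
        simp
      have h2 : Fin.tail (Fin.tail
          (v ∘ Equiv.swap (0 : Fin (n + 1)).castSucc (0 : Fin (n + 1)).succ)) =
          Fin.tail (Fin.tail v) := by
        funext j
        simp only [Fin.tail, Function.comp]
        rw [Equiv.swap_apply_of_ne_of_ne]
        · simp [Fin.ext_iff]
        · simp [Fin.ext_iff]
      rw [h0, h1, h2, hsymm]
    | succ j =>
      have ih : ∀ y (w : Fin (n + 1) → E),
          iteratedFDeriv ℝ (n + 1) f y (w ∘ Equiv.swap j.castSucc j.succ) =
          iteratedFDeriv ℝ (n + 1) f y w := fun y w => iteratedFDeriv_comp_swap hf n y w j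
      have hd : DifferentiableAt ℝ (iteratedFDeriv ℝ (n + 1) f) x :=
        (hf.differentiable_iteratedFDeriv (by exact_mod_cast WithTop.coe_lt_top _)) x
      have e1 : ∀ w : Fin (n + 1) → E, HasFDerivAt (fun y => iteratedFDeriv ℝ (n + 1) f y w)
          ((ContinuousMultilinearMap.apply ℝ (fun _ : Fin (n + 1) => E) E w).comp
            (fderiv ℝ (iteratedFDeriv ℝ (n + 1) f) x)) x := fun w =>
        (ContinuousMultilinearMap.apply ℝ (fun _ : Fin (n + 1) => E) E w).hasFDerivAt.comp x
          hd.hasFDerivAt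
      have h0 : (v ∘ Equiv.swap j.succ.castSucc j.succ.succ) 0 = v 0 := by
        simp only [Function.comp]
        rw [Equiv.swap_apply_of_ne_of_ne]
        · simp [Fin.ext_iff]
        · simp [Fin.ext_iff]
      have h1 : Fin.tail (v ∘ Equiv.swap j.succ.castSucc j.succ.succ) =
          Fin.tail v ∘ Equiv.swap j.castSucc j.succ := by
        funext k
        simp only [Fin.tail, Function.comp]
        congr 1
        rw [← Fin.succ_castSucc]
        exact (Fin.succ_injective _).swap_apply _ _ _
      rw [iteratedFDeriv_succ_apply_left, iteratedFDeriv_succ_apply_left, h0, h1]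
      have e2 := e1 (Fin.tail v ∘ Equiv.swap j.castSucc j.succ)
      simp only [ih] at e2
      exact congrArg (fun L => L (v 0)) (e2.unique (e1 (Fin.tail v)))

/-- The derivatives of a smooth map are symmetric. -/
theorem iteratedFDeriv_comp_perm_of_smooth {f : E → E} (hf : ContDiff ℝ ∞ f) {n : ℕ} (x : E)
    (v : Fin n → E) (ε : Equiv.Perm (Fin n)) :
    iteratedFDeriv ℝ n f x (v ∘ ε) = iteratedFDeriv ℝ n f x v := by
  rcases n with _ | n
  · exact congrArg _ (Subsingleton.elim _ _)
  · have hε : ε ∈ Submonoid.closure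
        (Set.range fun i : Fin n => Equiv.swap i.castSucc i.succ) := by
      rw [Equiv.Perm.mclosure_swap_castSucc_succ]; trivial
    induction hε using Submonoid.closure_induction generalizing v with
    | mem _ h =>
      obtain ⟨i, rfl⟩ := h
      exact iteratedFDeriv_comp_swap hf n x v i
    | one => rfl
    | mul a b _ _ ha hb => exact (hb (v ∘ a)).trans (ha v)

/-- The elementary differential `F(t)`, as a function of the point. -/
def elemDiff (f : E → E) : PTree → E → E
  | node n c => fun y => iteratedFDeriv ℝ n f y fun i => elemDiff f (c i) y

theorem Iso.elemDiff_eq {f : E → E} (hf : ContDiff ℝ ∞ f) :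
    (s t : PTree) → Iso s t → elemDiff f s = elemDiff f t
  | node n c, node m d, h => by
    obtain ⟨ε, hε⟩ := iso_node h
    obtain rfl : n = m := by simpa using Fintype.card_congr ε
    funext y
    have h1 : ∀ i, elemDiff f (c i) y = elemDiff f (d (ε i)) y := fun i =>
      congrFun (Iso.elemDiff_eq hf _ _ (hε i)) y
    rw [elemDiff, elemDiff]
    simp only [h1]
    exact iteratedFDeriv_comp_perm_of_smooth hf y (fun j => elemDiff f (d j) y) ε

end ElementaryDifferential

/-- The maps of `Π(s, t)`: injective maps of the vertices of `s` to those of `t` that preserve the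
root and the edges. -/
structure IsEmbedding (s t : PTree) (π : Vert s → Vert t) : Prop where
  injective : Function.Injective π
  map_root : π (root s) = root t
  map_edge : ∀ u v, Edge s u v → Edge t (π u) (π v)

open Classical in
/-- The vertex sets `π(V(s))`, `π ∈ Π(s, t)`: the vertex sets of the copies of `s` in `t` that
contain the root. -/
def copies (s t : PTree) : Finset (Finset (Vert t)) :=
  Finset.univ.filter fun S => ∃ π, IsEmbedding s t π ∧ Finset.univ.image π = S

end PTree

/-- Rooted trees: plane trees up to isomorphism of rooted trees. -/
def RTree : Type := Quotient PTree.setoid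

namespace PTree

/-- The rooted tree given by a plane tree. -/
def toRTree (t : PTree) : RTree := Quotient.mk setoid t

open Classical in
/-- The forest `G(V(t) ∖ S)`, where `S` is the vertex set of a copy of some tree at the root of `t`
(so `S` is closed under taking parents), as a monomial in trees. Each component of the induced
graph has a vertex nearest to the root, which is a vertex `v ∉ S` with parent in `S`, and consists
of `v` and all its descendants. -/
def restForest (t : PTree) (S : Finset (Vert t)) : MvPolynomial RTree ℝ :=
  ∏ v ∈ Finset.univ.filter (fun v => v ∉ S ∧ ∃ u ∈ S, Edge t u v),
    MvPolynomial.X (subtreeAt t v).toRTree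

/-- The pruning `t ∖ s`: the sum of the forests left by the copies of `s` at the root of `t`. -/
def prune (t s : PTree) : MvPolynomial RTree ℝ := ∑ S ∈ copies s t, restForest t S

theorem IsEmbedding.comp {r s t : PTree} {π : Vert r → Vert s} {ρ : Vert s → Vert t}
    (hρ : IsEmbedding s t ρ) (hπ : IsEmbedding r s π) : IsEmbedding r t (ρ ∘ π) :=
  ⟨hρ.injective.comp hπ.injective, by simp [hπ.map_root, hρ.map_root],
    fun u v h => hρ.map_edge _ _ (hπ.map_edge u v h)⟩

theorem Iso.exists_embedding {s t : PTree} (h : Iso s t) : ∃ π, IsEmbedding s t π := by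
  obtain ⟨e, h0, h⟩ := h
  exact ⟨e, e.injective, h0, fun u v => (h u v).1⟩

theorem copies_subset_left {s s' t : PTree} (h : Iso s' s) : copies s t ⊆ copies s' t := by
  classical
  obtain ⟨e, h0, h⟩ := h
  intro S hS
  simp only [copies, Finset.mem_filter, Finset.mem_univ, true_and] at hS ⊢
  obtain ⟨π, hπ, rfl⟩ := hS
  refine ⟨π ∘ e, hπ.comp ⟨e.injective, h0, fun u v => (h u v).1⟩, ?_⟩
  ext v
  simp only [Finset.mem_image, Finset.mem_univ, true_and, Function.comp]
  exact e.exists_congr_left.trans (by simp)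

theorem map_mem_copies {s t t' : PTree} (e : Vert t ≃ Vert t') (h0 : e (root t) = root t')
    (h : ∀ u v, Edge t u v ↔ Edge t' (e u) (e v)) {S : Finset (Vert t)} (hS : S ∈ copies s t) :
    S.map e.toEmbedding ∈ copies s t' := by
  classical
  simp only [copies, Finset.mem_filter, Finset.mem_univ, true_and] at hS ⊢
  obtain ⟨π, hπ, rfl⟩ := hS
  refine ⟨e ∘ π, IsEmbedding.comp ⟨e.injective, h0, fun u v => (h u v).1⟩ hπ, ?_⟩
  ext v
  simp [Equiv.eq_symm_apply]

theorem restForest_map {t t' : PTree} (e : Vert t ≃ Vert t') (h0 : e (root t) = root t')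
    (h : ∀ u v, Edge t u v ↔ Edge t' (e u) (e v)) (S : Finset (Vert t)) :
    restForest t S = restForest t' (S.map e.toEmbedding) := by
  classical
  refine Finset.prod_bij (fun v _ => e v) ?_ (fun _ _ _ _ h => e.injective h) ?_ ?_
  · intro v hv
    simp only [Finset.mem_filter, Finset.mem_univ, true_and] at hv ⊢
    obtain ⟨h1, u, hu, huv⟩ := hv
    exact ⟨by simpa using h1, e u, by simpa using hu, (h _ _).1 huv⟩
  · intro w hw
    simp only [Finset.mem_filter, Finset.mem_univ, true_and] at hw
    obtain ⟨h1, u, hu, huv⟩ := hw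
    refine ⟨e.symm w, ?_, by simp⟩
    simp only [Finset.mem_filter, Finset.mem_univ, true_and]
    refine ⟨fun h2 => h1 (Finset.mem_map.2 ⟨_, h2, by simp⟩), e.symm u, ?_, ?_⟩
    · obtain ⟨x, hx, rfl⟩ := Finset.mem_map.1 hu
      simpa using hx
    · rw [h]; simpa using huv
  · intro v _
    exact congrArg _ (Quotient.sound (iso_subtreeAt t t' e h0 h v))

theorem Iso.prune_eq {t t' s s' : PTree} (ht : Iso t t') (hs : Iso s s') :
    prune t s = prune t' s' := by
  have hc : copies s t = copies s' t :=
    (copies_subset_left (setoid.symm hs)).antisymm (copies_subset_left hs)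
  obtain ⟨e, h0, h⟩ := ht
  have h0' : e.symm (root t') = root t := by rw [← h0, e.symm_apply_apply]
  have h' : ∀ u v, Edge t' u v ↔ Edge t (e.symm u) (e.symm v) := fun u v => by
    rw [h, e.apply_symm_apply, e.apply_symm_apply]
  rw [prune, prune, hc]
  refine Finset.sum_bij (fun S _ => S.map e.toEmbedding) (fun S hS => map_mem_copies e h0 h hS)
    (fun _ _ _ _ h => Finset.map_injective _ h) (fun S hS => ?_) fun S _ => restForest_map e h0 h S
  refine ⟨S.map e.symm.toEmbedding, map_mem_copies e.symm h0' h' hS, ?_⟩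
  ext v
  simp

end PTree

namespace RTree

/-- The order `|t|`. -/
def order : RTree → ℕ := Quotient.lift PTree.order fun _ _ h => PTree.Iso.order_eq h

/-- The symmetry `σ(t)`. -/
def symmetry : RTree → ℕ := Quotient.lift PTree.symmetry fun _ _ h => PTree.Iso.symmetry_eq _ _ h

/-- The elementary differential `F(t)` of a smooth `f`, as a function of the point. -/
def elemDiff {E : Type*} [NormedAddCommGroup E] [NormedSpace ℝ E] (f : E → E)
    (hf : ContDiff ℝ ∞ f) : RTree → E → E :=
  Quotient.lift (PTree.elemDiff f) fun _ _ h => PTree.Iso.elemDiff_eq hf _ _ h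

/-- `s ≤ t`: the tree `s` is a subtree of `t` (with the same root). -/
instance : LE RTree where
  le := Quotient.lift₂ (fun s t => ∃ π, PTree.IsEmbedding s t π) fun _ _ _ _ hs ht => by
    obtain ⟨p, hp⟩ := PTree.Iso.exists_embedding hs
    obtain ⟨p', hp'⟩ := PTree.Iso.exists_embedding (PTree.setoid.symm hs)
    obtain ⟨q, hq⟩ := PTree.Iso.exists_embedding ht
    obtain ⟨q', hq'⟩ := PTree.Iso.exists_embedding (PTree.setoid.symm ht)
    exact propext ⟨fun ⟨π, h⟩ => ⟨_, hq.comp (h.comp hp')⟩, fun ⟨π, h⟩ => ⟨_, hq'.comp (h.comp hp)⟩⟩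

/-- The pruning `t ∖ s`, an element of the forest space: the ring of formal linear combinations of
forests (monomials in trees) with real coefficients. -/
def prune : RTree → RTree → MvPolynomial RTree ℝ :=
  Quotient.lift₂ PTree.prune fun _ _ _ _ ht hs => PTree.Iso.prune_eq ht hs

theorem finite_order_eq (n : ℕ) : {t : RTree | order t = n}.Finite := by
  refine ((PTree.finite_order_le n).image PTree.toRTree).subset ?_
  intro t
  induction t using Quotient.inductionOn with
  | h t => exact fun h => ⟨t, le_of_eq h, rfl⟩

/-- The finite set of the trees of order `n`. -/
def ofOrder (n : ℕ) : Finset RTree := (finite_order_eq n).toFinset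

end RTree

/-- The homomorphic extension to the forest space of a map `a` on `∅` and the trees
(`none` stands for `∅`). -/
def forestMap (a : Option RTree → ℝ) : MvPolynomial RTree ℝ →+* ℝ :=
  MvPolynomial.eval fun t => a (some t)

section FormalSeries

variable {E : Type*}

/-- Formal power series in `h` with coefficients in `E`: the series `∑ₙ hⁿ s(n)`. -/
abbrev FormalSeries (E : Type*) : Type _ := ℕ → E

/-- The product of `h ^ k` and a formal series. -/
def hPowMul [Zero E] (k : ℕ) (s : FormalSeries E) : FormalSeries E :=
  fun n => if k ≤ n then s (n - k) else 0

open Classical in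
/-- The formal series `∑ h^|t| w(t)`, where `t` runs through the trees in `S`. -/
def treeSeries [AddCommMonoid E] (S : Set RTree) (w : RTree → E) : FormalSeries E :=
  fun n => ∑ t ∈ (RTree.ofOrder n).filter (· ∈ S), w t

variable [NormedAddCommGroup E] [NormedSpace ℝ E]

/-- The value `g(Y)` of a smooth map `g` at a formal series `Y`, as a formal series: the
Taylor series of `g` at the constant term `Y 0`, i.e. `∑ₖ g⁽ᵏ⁾(Y 0)(δ, …, δ) / k!` with
`δ = Y - Y 0 = ∑_{n ≥ 1} hⁿ Y(n)`, expanded in powers of `h`. -/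
def evalAt (g : E → E) (Y : FormalSeries E) : FormalSeries E :=
  fun n => ∑ c : Composition n,
    (c.length.factorial : ℝ)⁻¹ • iteratedFDeriv ℝ c.length g (Y 0) fun i => Y (c.blocksFun i)

/-- The B-series `(B_h a) y₀ = a(∅) y₀ + ∑ₜ h^|t| a(t) / σ(t) F(t)(y₀)`. -/
def bSeries (f : E → E) (hf : ContDiff ℝ ∞ f) (a : Option RTree → ℝ) (y₀ : E) : FormalSeries E :=
  (fun n => if n = 0 then a none • y₀ else 0) +
    treeSeries Set.univ fun t => (a (some t) / t.symmetry) • t.elemDiff f hf y₀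

end FormalSeries

end BSeries

end

/-! Let `embSum a s t` be the sum, over all embeddings `π` of `s` into `t`, of the value of `a` on
the forest left by the image. The automorphisms of `s` act simply transitively on the embeddings
with a given image, and there are `σ(s)` of them, so `embSum a s t = σ(s) a(t ∖ s)`
(`symmetry_mul_forestMap_prune`). The factor `1 / σ(t')` thus cancels, and it remains to show that
`h^|s| F(s)` along the B-series is `∑ h^|t| / σ(t) · embSum a s t · F(t)`.

This goes by induction on `s = [c₁ ⋯ cₘ]`. In Taylor's formula for `f⁽ᵐ⁾` the term of order `k` has
`m` arguments `h^|cᵢ| F(cᵢ)`, which are expanded by induction, and `k` arguments `δ`, the B-series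
without its constant term. Multilinearity picks a tree in each of the `m + k` arguments, and these
are the branches of a new tree. By the symmetry of the derivative, the positions of the `m` special
arguments may be averaged over all injections. On the other side, an embedding is an injection of
the branches together with embeddings of the branches, and the branches that are missed contribute
`a` (`embSum_node`): this is the same recursion.

The expansion yields ordered tuples of branches, hence sums over plane trees, weighted by `1 /
weight`. They become sums over rooted trees with weights `1 / σ` because the plane forms of `s` have
total weight `1 / σ(s)` (`sum_ofOrder_eq`). This and the count of automorphisms both come from the
recursion at `a = 0`, where only isomorphisms contribute.

The formal identity is obtained from estimates modulo `O(h^(N+1))` for genuine functions of `h`: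
`isBigO_sub_evalAt` expands by formal substitution, `isBigO_elemDiff_sub_planeSum` expands over
trees, and `eq_zero_of_isBigO` compares coefficients. -/

namespace BSeries

/-! ### Embeddings of trees and the forests they leave. -/

namespace PTree

/-- The vertex of a tree given by a vertex of a branch. -/
def inBranch {n : ℕ} {d : Fin n → PTree} (j : Fin n) (w : Vert (d j)) : Vert (node n d) :=
  some ⟨j, w⟩

theorem prod_vert_node {M : Type*} [CommMonoid M] {n : ℕ} (d : Fin n → PTree)
    (g : Vert (node n d) → M) :
    ∏ v, g v = g (root (node n d)) * ∏ j, ∏ w : Vert (d j), g (inBranch j w) := by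
  have h : ∏ v, g v = ∏ v : Option (Σ i, Vert (d i)), g v :=
    Fintype.prod_equiv (Equiv.refl _) _ _ fun _ => rfl
  refine h.trans ((Fintype.prod_option fun v : Option (Σ i, Vert (d i)) => g v).trans ?_)
  exact congrArg (g none * ·) (Fintype.prod_sigma fun x : Σ i, Vert (d i) => g (some x))

theorem edge_same_branch {n : ℕ} {d : Fin n → PTree} {i j : Fin n} {u : Vert (d i)}
    {v : Vert (d j)} (h : Edge (node n d) (some ⟨i, u⟩) (some ⟨j, v⟩)) : i = j := h.1

theorem Edge.unique_left : (t : PTree) → {u u' v : Vert t} → Edge t u v → Edge t u' v → u = u'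
  | node _ _, _, _, none, h, _ => h.elim
  | node _ _, none, none, some _, _, _ => rfl
  | node _ d, none, some ⟨i, u⟩, some ⟨j, v⟩, h, h' => by
    obtain ⟨rfl, h'⟩ := h'
    have h : v = root (d i) := h
    exact (Edge.not_root (h ▸ h')).elim
  | node _ d, some ⟨i, u⟩, none, some ⟨j, v⟩, h', h => by
    obtain ⟨rfl, h'⟩ := h'
    have h : v = root (d i) := h
    exact (Edge.not_root (h ▸ h')).elim
  | node _ d, some ⟨i, u⟩, some ⟨k, w⟩, some ⟨j, v⟩, h, h' => by
    obtain ⟨rfl, h⟩ := h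
    obtain ⟨rfl, h'⟩ := h'
    have h : Edge (d k) u v := h
    exact congrArg (inBranch k) (Edge.unique_left (d k) h h')

theorem Edge.exists_left : (t : PTree) → (v : Vert t) → v ≠ root t → ∃ u, Edge t u v
  | node _ _, none, h => (h rfl).elim
  | node _ d, some ⟨i, v⟩, _ => by
    by_cases hv : v = root (d i)
    · exact ⟨none, hv⟩
    · obtain ⟨u, hu⟩ := Edge.exists_left (d i) v hv
      exact ⟨some ⟨i, u⟩, (edge_some_iff i u v).2 hu⟩

/-- An embedding reflects edges. -/
theorem IsEmbedding.edge_iff {s t : PTree} {π : Vert s → Vert t} (h : IsEmbedding s t π)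
    (u v : Vert s) : Edge s u v ↔ Edge t (π u) (π v) := by
  refine ⟨h.map_edge u v, fun huv => ?_⟩
  have hv : v ≠ root s := by
    rintro rfl
    rw [h.map_root] at huv
    exact Edge.not_root huv
  -- If `w` is the parent of `v`, then `π w` and `π u` are both parents of `π v`, so they coincide
  -- and `w = u`.
  obtain ⟨w, hw⟩ := Edge.exists_left s v hv
  rwa [← h.injective (Edge.unique_left t (h.map_edge w v hw) huv)]

open Classical in
theorem forestMap_restForest (a : Option RTree → ℝ) (t : PTree) (S : Finset (Vert t)) :
    forestMap a (restForest t S) =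
      ∏ v, if v ∉ S ∧ ∃ u ∈ S, Edge t u v then a (some (subtreeAt t v).toRTree) else 1 := by
  rw [restForest, map_prod, ← Finset.prod_filter]
  exact Finset.prod_congr rfl fun v _ => by simp [forestMap]

open Classical in
/-- The part of a vertex set that lies in a given branch. -/
noncomputable def branchPart {n : ℕ} {d : Fin n → PTree} (S : Finset (Vert (node n d)))
    (j : Fin n) : Finset (Vert (d j)) :=
  Finset.univ.filter fun w => inBranch j w ∈ S

theorem mem_branchPart {n : ℕ} {d : Fin n → PTree} {S : Finset (Vert (node n d))} {j : Fin n}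
    {w : Vert (d j)} : w ∈ branchPart S j ↔ inBranch j w ∈ S := by
  simp [branchPart]

-- As the root is removed, each remaining component lies in one branch. By `hS`, a branch whose root
-- is not removed is untouched and is itself a component.
open Classical in
theorem forestMap_restForest_node (a : Option RTree → ℝ) {n : ℕ} {d : Fin n → PTree}
    (S : Finset (Vert (node n d))) (h0 : root (node n d) ∈ S)
    (hS : ∀ j, root (d j) ∉ branchPart S j → branchPart S j = ∅) :
    forestMap a (restForest (node n d) S) = ∏ j, if root (d j) ∈ branchPart S j
      then forestMap a (restForest (d j) (branchPart S j)) else a (some (d j).toRTree) := by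
  rw [forestMap_restForest, prod_vert_node, if_neg (fun h => h.1 h0), one_mul]
  refine Finset.prod_congr rfl fun j _ => ?_
  split_ifs with hj
  · rw [forestMap_restForest]
    refine Finset.prod_congr rfl fun w _ => ?_
    have : (inBranch j w ∉ S ∧
        ∃ u ∈ S, Edge (node n d) u (inBranch j w)) ↔
        (w ∉ branchPart S j ∧ ∃ u ∈ branchPart S j, Edge (d j) u w) := by
      rw [mem_branchPart]
      refine and_congr_right fun hw => ⟨?_, ?_⟩
      · rintro ⟨_ | ⟨i, u⟩, hu, huw⟩
        · have : w = root (d j) := huw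
          subst this
          exact (hw (mem_branchPart.1 hj)).elim
        · obtain rfl := edge_same_branch huw
          exact ⟨u, mem_branchPart.2 hu, (edge_some_iff i u w).1 huw⟩
      · rintro ⟨u, hu, huw⟩
        exact ⟨inBranch j u, mem_branchPart.1 hu, (edge_some_iff j u w).2 huw⟩
    simp only [this]
    rfl
  · have he := hS j hj
    have : ∀ w : Vert (d j), (inBranch j w ∉ S ∧
        ∃ u ∈ S, Edge (node n d) u (inBranch j w)) ↔ w = root (d j) := by
      intro w
      constructor
      · rintro ⟨hw, _ | ⟨i, u⟩, hu, huw⟩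
        · exact huw
        · obtain rfl := edge_same_branch huw
          have := mem_branchPart.2 hu
          rw [he] at this
          simp at this
      · rintro rfl
        exact ⟨fun h => hj (mem_branchPart.2 h), none, h0, rfl⟩
    simp only [this]
    rw [Finset.prod_ite_eq' Finset.univ (root (d j)), if_pos (Finset.mem_univ _)]
    have : subtreeAt (node n d) (inBranch j (root (d j))) = d j := by
      change subtreeAt (d j) (root (d j)) = d j
      cases d j
      rfl
    rw [this]

/-- Embeddings of trees, as a type. -/
abbrev Emb (s t : PTree) : Type := {π : Vert s → Vert t // IsEmbedding s t π}

open Classical in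
noncomputable instance (s t : PTree) : Fintype (Emb s t) :=
  inferInstanceAs (Fintype {π : Vert s → Vert t // IsEmbedding s t π})

/-- The embedding of trees given by embeddings of the branches. -/
def glue {m n : ℕ} {c : Fin m → PTree} {d : Fin n → PTree}
    (x : Σ ι : Fin m ↪ Fin n, ∀ i, Emb (c i) (d (ι i))) : Emb (node m c) (node n d) where
  val v := match v with
    | none => none
    | some ⟨i, v⟩ => some ⟨x.1 i, (x.2 i).1 v⟩
  property := by
    obtain ⟨ι, π⟩ := x
    refine ⟨?_, rfl, ?_⟩
    · rintro (_ | ⟨i, u⟩) (_ | ⟨j, v⟩) h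
      · rfl
      · exact nomatch h
      · exact nomatch h
      · have h := Option.some.inj h
        obtain rfl := ι.injective (congrArg Sigma.fst h)
        have h : (π i).1 u = (π i).1 v := by simpa using h
        rw [(π i).2.injective h]
    · rintro (_ | ⟨i, u⟩) (_ | ⟨j, v⟩) h
      · exact h.elim
      · have h : v = root (c j) := h
        subst h
        exact (π j).2.map_root
      · exact h.elim
      · obtain ⟨rfl, h⟩ := h
        exact (edge_some_iff _ _ _).2 ((π i).2.map_edge u v h)

/-- An embedding sends children of the root to distinct children of the root, and edges keep the
rest of each branch inside the branch so chosen. -/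
theorem glue_bijective {m n : ℕ} (c : Fin m → PTree) (d : Fin n → PTree) :
    Function.Bijective (glue (c := c) (d := d)) := by
  constructor
  · rintro ⟨ι, π⟩ ⟨κ, ρ⟩ h
    have key : ∀ i v, (⟨ι i, (π i).1 v⟩ : Σ j, Vert (d j)) = ⟨κ i, (ρ i).1 v⟩ := fun i v =>
      Option.some.inj (congrFun (congrArg Subtype.val h) (some ⟨i, v⟩))
    obtain rfl : ι = κ := by
      ext i
      rw [show ι i = κ i from congrArg Sigma.fst (key i (root (c i)))]
    congr 1
    funext i
    refine Subtype.ext (funext fun v => ?_)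
    simpa using key i v
  · rintro ⟨π, hπ⟩
    have hroot : π none = none := hπ.map_root
    have h1 : ∀ i, ∃ j, π (some ⟨i, root (c i)⟩) = some ⟨j, root (d j)⟩ := by
      intro i
      have h : Edge (node n d) (π none) (π (some ⟨i, root (c i)⟩)) := hπ.map_edge _ _ rfl
      rw [hroot] at h
      rcases hx : π (some ⟨i, root (c i)⟩) with _ | ⟨j, w⟩
      · rw [hx] at h; exact h.elim
      · rw [hx] at h
        have hw : w = root (d j) := h
        exact ⟨j, by rw [hw]⟩
    choose p hp using h1
    have h2 : ∀ i v, ∃ w, π (some ⟨i, v⟩) = some ⟨p i, w⟩ := by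
      intro i
      refine vert_induction _ _ ⟨_, hp i⟩ ?_
      rintro u v huv ⟨w, hw⟩
      have h := hπ.map_edge _ _ ((edge_some_iff i u v).2 huv)
      rw [hw] at h
      rcases hx : π (some ⟨i, v⟩) with _ | ⟨k, x⟩
      · rw [hx] at h; exact h.elim
      · rw [hx] at h
        obtain rfl := edge_same_branch h
        exact ⟨x, rfl⟩
    choose q hq using h2
    have hpi : Function.Injective p := by
      intro i j hij
      have : π (some ⟨i, root (c i)⟩) = π (some ⟨j, root (c j)⟩) := by rw [hp, hp, hij]
      exact congrArg Sigma.fst (Option.some.inj (hπ.injective this))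
    refine ⟨⟨⟨p, hpi⟩, fun i => ⟨q i, ?_, ?_, ?_⟩⟩, ?_⟩
    · intro u v huv
      have : π (some ⟨i, u⟩) = π (some ⟨i, v⟩) := by rw [hq, hq, huv]
      simpa using Option.some.inj (hπ.injective this)
    · simpa using Option.some.inj ((hq i _).symm.trans (hp i))
    · intro u v huv
      have h := hπ.map_edge _ _ ((edge_some_iff i u v).2 huv)
      rw [hq, hq] at h
      exact (edge_some_iff (p i) _ _).1 h
    · refine Subtype.ext (funext ?_)
      rintro (_ | ⟨i, v⟩)
      · exact hroot.symm
      · exact (hq i v).symm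

/-- The vertex set of the image of a map. -/
noncomputable def imageSet {s t : PTree} (π : Vert s → Vert t) : Finset (Vert t) :=
  @Finset.image _ _ (Classical.decEq _) π Finset.univ

theorem mem_imageSet {s t : PTree} {π : Vert s → Vert t} {w : Vert t} :
    w ∈ imageSet π ↔ ∃ v, π v = w := by
  simp [imageSet]

/-- The sum of the values of `a` on the forests that remain when the images of the embeddings of
`s` into `t` are removed. -/
noncomputable def embSum (a : Option RTree → ℝ) (s t : PTree) : ℝ :=
  ∑ π : Emb s t, forestMap a (restForest t (imageSet π.1))

/-- A branch hit by `ι` loses the image of one branch of the source; a branch that is missed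
survives whole as one component. -/
theorem forestMap_restForest_glue (a : Option RTree → ℝ) {m n : ℕ} {c : Fin m → PTree}
    {d : Fin n → PTree}
    (x : Σ ι : Fin m ↪ Fin n, ∀ i, Emb (c i) (d (ι i))) :
    forestMap a (restForest (node n d) (imageSet (glue x).1)) =
      (∏ i, forestMap a (restForest (d (x.1 i)) (imageSet (x.2 i).1))) *
        ∏ j ∈ Finset.univ.filter (fun j => j ∉ Set.range x.1), a (some (d j).toRTree) := by
  classical
  obtain ⟨ι, π⟩ := x
  set S := imageSet (glue (⟨ι, π⟩ : Σ ι : Fin m ↪ Fin n, ∀ i, Emb (c i) (d (ι i)))).1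
    with hSdef
  have hmem : ∀ j (w : Vert (d j)), w ∈ branchPart S j ↔
      ∃ i v, (⟨ι i, (π i).1 v⟩ : Σ j, Vert (d j)) = ⟨j, w⟩ := by
    intro j w
    rw [mem_branchPart, hSdef, mem_imageSet]
    constructor
    · rintro ⟨_ | ⟨i, v⟩, h⟩
      · exact nomatch h
      · exact ⟨i, v, Option.some.inj h⟩
    · rintro ⟨i, v, h⟩
      exact ⟨some ⟨i, v⟩, congrArg some h⟩
  have hpart : ∀ i, branchPart S (ι i) = imageSet (π i).1 := by
    intro i
    ext w
    rw [hmem]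
    rw [mem_imageSet]
    constructor
    · rintro ⟨k, v, h⟩
      obtain rfl := ι.injective (congrArg Sigma.fst h)
      exact ⟨v, by simpa using h⟩
    · rintro ⟨v, rfl⟩
      exact ⟨i, v, rfl⟩
  have hempty : ∀ j, j ∉ Set.range ι → branchPart S j = ∅ := by
    intro j hj
    refine Finset.eq_empty_of_forall_notMem fun w hw => hj ?_
    obtain ⟨i, v, h⟩ := (hmem j w).1 hw
    exact ⟨i, congrArg Sigma.fst h⟩
  have hroot : ∀ i, root (d (ι i)) ∈ branchPart S (ι i) := by
    intro i
    rw [hpart]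
    exact mem_imageSet.2 ⟨_, (π i).2.map_root⟩
  rw [forestMap_restForest_node]
  · rw [← Finset.prod_filter_mul_prod_filter_not Finset.univ (fun j => j ∈ Set.range ι)]
    congr 1
    · have : Finset.univ.filter (fun j => j ∈ Set.range ι) = Finset.univ.map ι := by
        ext j; simp
      rw [this, Finset.prod_map]
      exact Finset.prod_congr rfl fun i _ => by rw [if_pos (hroot i), hpart]
    · refine Finset.prod_congr rfl fun j hj => ?_
      rw [if_neg]
      rw [hempty j (by simpa using hj)]
      simp
  · exact mem_imageSet.2 ⟨none, rfl⟩
  · intro j hj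
    refine hempty j ?_
    rintro ⟨i, rfl⟩
    exact hj (hroot i)

/-- For a fixed `ι` the embeddings of the branches are chosen independently, so the sum of products
is a product of sums. `Function.extend` attaches one function of trees to each position `j`, the
form in which the arguments of a multilinear map are expanded later. -/
theorem embSum_node (a : Option RTree → ℝ) {m n : ℕ} (c : Fin m → PTree) (d : Fin n → PTree) :
    embSum a (node m c) (node n d) = ∑ ι : Fin m ↪ Fin n, ∏ j,
      Function.extend ι (fun i => embSum a (c i)) (fun _ t => a (some t.toRTree)) j (d j) := by
  classical
  rw [embSum, ← Function.Bijective.sum_comp (glue_bijective c d)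
    (fun π => forestMap a (restForest (node n d) (imageSet π.1))), Fintype.sum_sigma]
  refine Finset.sum_congr rfl fun ι _ => ?_
  simp only [forestMap_restForest_glue]
  rw [← Finset.sum_mul, ← Fintype.prod_sum (fun i (π : Emb (c i) (d (ι i))) =>
    forestMap a (restForest (d (ι i)) (imageSet π.1))),
    ← Finset.prod_filter_mul_prod_filter_not Finset.univ (fun j => j ∈ Set.range ι)]
  congr 1
  · have : Finset.univ.filter (fun j => j ∈ Set.range ι) = Finset.univ.map ι := by
      ext j; simp
    rw [this, Finset.prod_map]
    refine Finset.prod_congr rfl fun i _ => ?_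
    rw [ι.injective.extend_apply]
    rfl
  · refine Finset.prod_congr rfl fun j hj => ?_
    rw [Function.extend_apply']
    simpa using hj

end PTree

end BSeries

/-! ### Automorphisms, the symmetry, and sums over plane trees. -/

namespace BSeries

theorem RTree.mem_ofOrder {n : ℕ} {t : RTree} : t ∈ RTree.ofOrder n ↔ t.order = n :=
  Set.Finite.mem_toFinset _

namespace PTree

theorem imageSet_eq_univ {s : PTree} (π : Emb s s) : imageSet π.1 = Finset.univ := by
  ext v
  simpa [mem_imageSet] using (Finite.injective_iff_surjective.1 π.2.injective) v

/-- An embedding of a finite tree into itself is onto, so it leaves the empty forest, whose value is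
`1` even for `a = 0`. -/
theorem embSum_zero_self (s : PTree) : embSum 0 s s = Fintype.card (Emb s s) := by
  have : ∀ π : Emb s s, forestMap 0 (restForest s (imageSet π.1)) = 1 := fun π => by
    rw [imageSet_eq_univ, forestMap_restForest]
    exact Finset.prod_eq_one fun v _ => if_neg fun h => h.1 (Finset.mem_univ _)
  simp [embSum, this]

theorem iso_node_of_branches {n m : ℕ} {c : Fin n → PTree} {d : Fin m → PTree} (ε : Fin n ≃ Fin m)
    (h : ∀ i, Iso (c i) (d (ε i))) : Iso (node n c) (node m d) := by
  choose e he using h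
  let π := glue (c := c) (d := d) ⟨ε.toEmbedding, fun i =>
    ⟨e i, (e i).injective, (he i).1, fun u v => ((he i).2 u v).1⟩⟩
  have hs : Function.Surjective π.1 := by
    rintro (_ | ⟨j, w⟩)
    · exact ⟨none, rfl⟩
    · obtain ⟨i, rfl⟩ := ε.surjective j
      obtain ⟨v, rfl⟩ := (e i).surjective w
      exact ⟨inBranch i v, rfl⟩
  exact ⟨Equiv.ofBijective π.1 ⟨π.2.injective, hs⟩, π.2.map_root, π.2.edge_iff⟩

-- Composition with `ε₀⁻¹` carries these permutations to the stabilizer of the colouring `i ↦ ⟦c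
-- i⟧`, whose order is the product of the factorials of the sizes of the colour classes.
open Classical in
theorem card_perm_branches {n : ℕ} (c d : Fin n → PTree) (h : Iso (node n c) (node n d)) :
    Fintype.card {ε : Equiv.Perm (Fin n) // ∀ i, Iso (c i) (d (ε i))} =
      ∏ s ∈ Finset.univ.image (fun i => (⟦c i⟧ : Quotient setoid)),
        (Finset.univ.filter fun i => (⟦c i⟧ : Quotient setoid) = s).card.factorial := by
  obtain ⟨ε₀, h₀⟩ := iso_node h
  have h1 := DomMulAct.stabilizer_card' (fun i => (⟦c i⟧ : Quotient setoid))
  simp only [Fintype.card_subtype] at h1 ⊢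
  rw [← h1]
  refine Finset.card_bij (fun ε _ => ε.trans ε₀.symm) ?_ ?_ ?_
  · intro ε hε
    simp only [Finset.mem_filter, Finset.mem_univ, true_and] at hε ⊢
    funext i
    refine Quotient.sound ?_
    refine setoid.trans (h₀ _) ?_
    simpa using setoid.symm (hε i)
  · intro ε _ ε' _ hh
    ext1 i
    simpa using Equiv.congr_fun hh i
  · intro g hg
    simp only [Finset.mem_filter, Finset.mem_univ, true_and] at hg
    refine ⟨g.trans ε₀, ?_, by ext; simp⟩
    simp only [Finset.mem_filter, Finset.mem_univ, true_and]
    intro i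
    exact setoid.trans (Quotient.exact (congrFun hg i).symm) (h₀ (g i))

open Classical in
/-- With all forests except the empty one given the value zero, only isomorphisms count. -/
theorem embSum_zero : (s t : PTree) → embSum 0 s t = if Iso s t then (symmetry s : ℝ) else 0
  | node m c, node n d => by
    have ih : ∀ i t, embSum 0 (c i) t = if Iso (c i) t then (symmetry (c i) : ℝ) else 0 :=
      fun i t => embSum_zero (c i) t
    rw [embSum_node]
    by_cases hmn : n = m
    · subst hmn
      have h1 : ∀ ι : Fin n ↪ Fin n, (∏ j, Function.extend ι (fun i => embSum 0 (c i))
          (fun _ t => (0 : Option RTree → ℝ) (some t.toRTree)) j (d j)) =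
          if ∀ i, Iso (c i) (d (ι i)) then ∏ i, (symmetry (c i) : ℝ) else 0 := by
        intro ι
        -- For equal arities `ι` is a permutation, so the default value `0` of `Function.extend`
        -- never occurs.
        rw [← (Equiv.ofBijective ι (Finite.injective_iff_bijective.1 ι.injective)).prod_comp]
        simp only [Equiv.ofBijective_apply, ι.injective.extend_apply, ih]
        split_ifs with h
        · exact Finset.prod_congr rfl fun i _ => if_pos (h i)
        · obtain ⟨i, hi⟩ := not_forall.1 h
          exact Finset.prod_eq_zero (Finset.mem_univ i) (if_neg hi)
      simp only [h1]
      have h2 : ∑ ι : Fin n ↪ Fin n, (if ∀ i, Iso (c i) (d (ι i))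
          then ∏ i, (symmetry (c i) : ℝ) else 0) =
          ∑ ε : Equiv.Perm (Fin n), (if ∀ i, Iso (c i) (d (ε i))
          then ∏ i, (symmetry (c i) : ℝ) else 0) :=
        (Fintype.sum_equiv (Equiv.embeddingEquivOfFinite (Fin n)).symm _ _ fun ε => rfl).symm
      rw [h2, ← Finset.sum_filter, Finset.sum_const, ← Fintype.card_subtype]
      split_ifs with h
      · rw [card_perm_branches c d h, symmetry]
        push_cast
        rw [nsmul_eq_mul]
        push_cast
        rfl
      · rw [Fintype.card_eq_zero_iff.2 ⟨fun x => h (iso_node_of_branches x.1 x.2)⟩, zero_smul]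
    · rw [if_neg]
      -- For different arities `ι` misses some branch, whose factor is the value `0` of `a`.
      · refine Finset.sum_eq_zero fun ι _ => ?_
        obtain ⟨j, hj⟩ : ∃ j, j ∉ Set.range ι := by
          by_contra! hc
          exact hmn (by simpa using (Fintype.card_of_bijective ⟨ι.injective, hc⟩).symm)
        refine Finset.prod_eq_zero (Finset.mem_univ j) ?_
        rw [Function.extend_apply' _ _ _ hj]
        rfl
      · intro h
        obtain ⟨ε, -⟩ := iso_node h
        exact hmn (by simpa using (Fintype.card_congr ε).symm)

/-- Both sides are values of `embSum 0 s s`: one counts directly, the other follows the recursion.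
-/
theorem card_emb_self (s : PTree) : Fintype.card (Emb s s) = symmetry s := by
  have := embSum_zero s s
  rw [embSum_zero_self, if_pos (show Iso s s from setoid.refl s)] at this
  exact_mod_cast this

theorem symmetry_pos (s : PTree) : 0 < symmetry s := by
  rw [← card_emb_self]
  exact Fintype.card_pos_iff.2 ⟨⟨id, Function.injective_id, rfl, fun _ _ h => h⟩⟩

/-- Since `π` reflects edges, it is an isomorphism onto its image, and `π⁻¹ ∘ ρ` makes sense as an
embedding of `s` into itself. -/
theorem exists_comp_of_imageSet_eq {s t : PTree} (π ρ : Emb s t)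
    (h : imageSet ρ.1 = imageSet π.1) : ∃ α : Emb s s, ρ.1 = π.1 ∘ α.1 := by
  have h1 : ∀ v, ∃ w, π.1 w = ρ.1 v := fun v =>
    mem_imageSet.1 (h ▸ mem_imageSet.2 ⟨v, rfl⟩)
  choose α hα using h1
  refine ⟨⟨α, ?_, ?_, ?_⟩, funext fun v => (hα v).symm⟩
  · intro u v huv
    exact ρ.2.injective (by rw [← hα, ← hα, huv])
  · exact π.2.injective (by rw [hα, ρ.2.map_root, π.2.map_root])
  · intro u v huv
    rw [π.2.edge_iff, hα, hα]
    exact ρ.2.map_edge u v huv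

theorem mem_copies {s t : PTree} {S : Finset (Vert t)} :
    S ∈ copies s t ↔ ∃ π : Emb s t, imageSet π.1 = S := by
  simp only [copies, Finset.mem_filter, Finset.mem_univ, true_and]
  exact ⟨fun ⟨π, h, h'⟩ => ⟨⟨π, h⟩, h'⟩, fun ⟨π, h⟩ => ⟨π.1, π.2, h⟩⟩

-- Composition with the automorphisms of `s` acts simply transitively on the embeddings with image
-- `S`.
open Classical in
theorem card_fiber_imageSet {s t : PTree} {S : Finset (Vert t)} (hS : S ∈ copies s t) :
    (Finset.univ.filter fun π : Emb s t => imageSet π.1 = S).card = symmetry s := by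
  obtain ⟨π, rfl⟩ := mem_copies.1 hS
  rw [← card_emb_self, ← Finset.card_univ]
  symm
  refine Finset.card_bij (fun α _ => ⟨π.1 ∘ α.1, π.2.comp α.2⟩) ?_ ?_ ?_
  · intro α _
    simp only [Finset.mem_filter, Finset.mem_univ, true_and]
    ext w
    simp only [mem_imageSet, Function.comp]
    constructor
    · rintro ⟨v, rfl⟩
      exact ⟨_, rfl⟩
    · rintro ⟨v, rfl⟩
      obtain ⟨u, rfl⟩ := (Finite.injective_iff_surjective.1 α.2.injective) v
      exact ⟨u, rfl⟩
  · intro α _ β _ h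
    refine Subtype.ext (funext fun v => π.2.injective ?_)
    exact congrFun (congrArg Subtype.val h) v
  · intro ρ hρ
    simp only [Finset.mem_filter, Finset.mem_univ, true_and] at hρ
    obtain ⟨α, hα⟩ := exists_comp_of_imageSet_eq π ρ hρ
    exact ⟨α, Finset.mem_univ _, Subtype.ext hα.symm⟩

/-- The pruning counts each image once, `embSum` once for each of the `σ(s)` embeddings with that
image. -/
theorem symmetry_mul_forestMap_prune (a : Option RTree → ℝ) (s t : PTree) :
    symmetry s * forestMap a (prune t s) = embSum a s t := by
  classical
  rw [prune, map_sum, embSum, Finset.mul_sum]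
  refine Eq.trans ?_ (Finset.sum_fiberwise_of_maps_to' (s := Finset.univ) (t := copies s t)
    (g := fun π : Emb s t => imageSet π.1) (fun π _ => mem_copies.2 ⟨π, rfl⟩)
    fun S => forestMap a (restForest t S))
  refine Finset.sum_congr rfl fun S hS => ?_
  rw [Finset.sum_const, card_fiber_imageSet hS, nsmul_eq_mul]

/-- The plane trees of order at most `N`. -/
noncomputable def orderLE (N : ℕ) : Finset PTree := (finite_order_le N).toFinset

theorem mem_orderLE {N : ℕ} {t : PTree} : t ∈ orderLE N ↔ order t ≤ N := by
  simp [orderLE]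

/-- The product over the vertices of the factorials of the numbers of children. -/
def weight : PTree → ℕ
  | node n c => n.factorial * ∏ i, weight (c i)

theorem order_branch_lt {n : ℕ} (c : Fin n → PTree) (i : Fin n) :
    order (c i) < order (node n c) := by
  rw [order_node]
  have := Finset.single_le_sum (f := fun i => order (c i)) (fun _ _ => Nat.zero_le _)
    (Finset.mem_univ i)
  omega

theorem node_injective (n : ℕ) : Function.Injective (node n) := fun c d h => by
  simpa using h

/-- By `embSum_zero` this says that the plane forms of `s` have total weight `1 / σ(s)`. Each of the
`m!` bijections of the branches contributes a product of inner sums, all equal to `1` by induction,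
and the factor `m!` in the weight of the root compensates. The bound `N` only makes the sum finite.
-/
theorem sum_embSum_zero_div_weight : (s : PTree) → (N : ℕ) → order s ≤ N →
    ∑ t ∈ orderLE N, embSum 0 s t / weight t = 1
  | node m c, N, hN => by
    classical
    have ih : ∀ i, ∑ t ∈ orderLE N, embSum 0 (c i) t / weight t = 1 := fun i =>
      sum_embSum_zero_div_weight (c i) N ((order_branch_lt c i).le.trans hN)
    -- Only trees isomorphic to `node m c` contribute; they have `m` branches, so `t` may be
    -- replaced by a tuple of `m` branches chosen independently.
    have h1 : ∑ t ∈ orderLE N, embSum 0 (node m c) t / weight t =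
        ∑ t ∈ (Fintype.piFinset fun _ : Fin m => orderLE N).map ⟨node m, node_injective m⟩,
          embSum 0 (node m c) t / weight t := by
      rw [← Finset.sum_filter_ne_zero, ← Finset.sum_filter_ne_zero (s := Finset.map _ _)]
      refine Finset.sum_congr ?_ fun _ _ => rfl
      ext t
      simp only [Finset.mem_filter]
      refine and_congr_left fun ht => ?_
      have hiso : Iso (node m c) t := by
        by_contra h
        rw [embSum_zero, if_neg h, zero_div] at ht
        exact ht rfl
      obtain ⟨n, d⟩ := t
      obtain ⟨ε, hε⟩ := iso_node hiso
      obtain rfl : m = n := by simpa using Fintype.card_congr ε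
      have h2 : order (node m d) ≤ N := hiso.order_eq ▸ hN
      simp only [mem_orderLE, h2, true_iff, Finset.mem_map, Fintype.mem_piFinset]
      exact ⟨d, fun i => (order_branch_lt d i).le.trans h2, rfl⟩
    rw [h1, Finset.sum_map]
    simp only [Function.Embedding.coeFn_mk, embSum_node, Finset.sum_div]
    rw [Finset.sum_comm]
    have h2 : ∀ ι : Fin m ↪ Fin m, (∑ d ∈ Fintype.piFinset fun _ : Fin m => orderLE N,
        (∏ j, Function.extend ι (fun i => embSum 0 (c i))
          (fun _ t => (0 : Option RTree → ℝ) (some t.toRTree)) j (d j)) / weight (node m d)) =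
        (m.factorial : ℝ)⁻¹ := by
      intro ι
      have h3 : ∀ d : Fin m → PTree, (∏ j, Function.extend ι (fun i => embSum 0 (c i))
          (fun _ t => (0 : Option RTree → ℝ) (some t.toRTree)) j (d j)) / weight (node m d) =
          (m.factorial : ℝ)⁻¹ * ∏ j, (Function.extend ι (fun i => embSum 0 (c i))
          (fun _ t => (0 : Option RTree → ℝ) (some t.toRTree)) j (d j) / weight (d j)) := by
        intro d
        rw [weight, Finset.prod_div_distrib]
        push_cast
        field_simp
      simp only [h3]
      rw [← Finset.mul_sum, ← Finset.prod_univ_sum (fun _ => orderLE N)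
        (fun j t => Function.extend ι (fun i => embSum 0 (c i))
          (fun _ t => (0 : Option RTree → ℝ) (some t.toRTree)) j t / weight t),
        Finset.prod_eq_one, mul_one]
      intro j _
      obtain ⟨i, rfl⟩ := (Finite.injective_iff_surjective.1 ι.injective) j
      simp only [ι.injective.extend_apply, ih]
    simp only [h2, Finset.sum_const, Finset.card_univ, Fintype.card_embedding_eq,
      Fintype.card_fin, Nat.descFactorial_self, nsmul_eq_mul]
    exact mul_inv_cancel₀ (Nat.cast_ne_zero.2 m.factorial_ne_zero)

open Classical in
/-- A sum over rooted trees with the weights `1 / σ` is a sum over plane trees. -/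
theorem sum_ofOrder_eq {E : Type*} [AddCommGroup E] [Module ℝ E] (G : RTree → E) {n N : ℕ}
    (hn : n ≤ N) : ∑ t ∈ RTree.ofOrder n, (t.symmetry : ℝ)⁻¹ • G t =
      ∑ t ∈ (orderLE N).filter (fun t => order t = n), (weight t : ℝ)⁻¹ • G t.toRTree := by
  rw [← Finset.sum_fiberwise_of_maps_to (t := RTree.ofOrder n) (g := toRTree)]
  swap
  · intro t ht
    exact RTree.mem_ofOrder.2 (Finset.mem_filter.1 ht).2
  refine Finset.sum_congr rfl fun t ht => ?_
  rw [Finset.sum_congr rfl (g := fun u : PTree => (weight u : ℝ)⁻¹ • G t)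
    fun u hu => by rw [(Finset.mem_filter.1 hu).2], ← Finset.sum_smul]
  congr 1
  induction t using Quotient.inductionOn with
  | h s =>
    have hs : order s = n := RTree.mem_ofOrder.1 ht
    change (symmetry s : ℝ)⁻¹ = _
    have h1 := sum_embSum_zero_div_weight s N (hs.trans_le hn)
    simp only [embSum_zero, ite_div, zero_div] at h1
    rw [← Finset.sum_filter] at h1
    simp only [div_eq_mul_inv] at h1
    rw [← Finset.mul_sum] at h1
    rw [← eq_inv_of_mul_eq_one_right h1]
    refine Finset.sum_congr ?_ fun _ _ => rfl
    ext u
    simp only [Finset.mem_filter, and_assoc]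
    refine and_congr_right fun _ => ⟨fun h => ⟨hs ▸ h.order_eq.symm, ?_⟩, fun h => ?_⟩
    · exact Quotient.sound (setoid.symm h)
    · exact setoid.symm (Quotient.exact h.2)

end PTree

end BSeries

namespace BSeries

open Asymptotics Filter Topology

/-! ### Taylor's theorem and asymptotic expansions. -/

section Analysis

variable {E F : Type*} [NormedAddCommGroup E] [NormedSpace ℝ E]
  [NormedAddCommGroup F] [NormedSpace ℝ F]

theorem contDiff_multilinear_apply {n : ℕ} {B : E → E [×n]→L[ℝ] F} {g : Fin n → E → E}
    (hB : ContDiff ℝ ∞ B) (hg : ∀ i, ContDiff ℝ ∞ (g i)) :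
    ContDiff ℝ ∞ fun y => B y fun i => g i y := by
  induction n with
  | zero =>
    have : (fun y => B y fun i => g i y) =
        fun y => ContinuousMultilinearMap.apply ℝ (fun _ : Fin 0 => E) F 0 (B y) := by
      funext y
      exact congrArg (B y) (Subsingleton.elim _ _)
    rw [this]
    exact (ContinuousLinearMap.contDiff _).comp hB
  | succ n ih =>
    have h1 : ContDiff ℝ ∞ fun y =>
        continuousMultilinearCurryLeftEquiv ℝ (fun _ : Fin (n + 1) => E) F (B y) :=
      (LinearIsometryEquiv.contDiff _).comp hB
    have h2 := ih (h1.clm_apply (hg 0)) fun i => hg i.succ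
    convert! h2 using 2 with y
    change _ = (B y) (Fin.cons (g 0 y) fun i : Fin n => g i.succ y)
    congr 1
    funext i
    refine Fin.cases ?_ (fun i => ?_) i <;> simp

theorem contDiff_iteratedFDeriv {f : E → F} (hf : ContDiff ℝ ∞ f) (m : ℕ) :
    ContDiff ℝ ∞ (iteratedFDeriv ℝ m f) :=
  hf.iteratedFDeriv_right (by exact_mod_cast le_top)

theorem PTree.contDiff_elemDiff {f : E → E} (hf : ContDiff ℝ ∞ f) :
    (t : PTree) → ContDiff ℝ ∞ (t.elemDiff f)
  | node n c => contDiff_multilinear_apply (contDiff_iteratedFDeriv hf n)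
      fun i => PTree.contDiff_elemDiff hf (c i)

/-- The tuple with `k` entries `x`, followed by the entries of `v`. -/
def consPow {m : ℕ} (x : E) (v : Fin m → E) : (k : ℕ) → Fin (m + k) → E
  | 0 => v
  | k + 1 => Fin.cons x (consPow x v k)

/-- In this form `consPow` belongs to one injection among many, which a permutation of the arguments
can exchange for any other. -/
theorem consPow_eq_extend {X : Type*} {m : ℕ} (x : X) (v : Fin m → X) (k : ℕ) :
    consPow x v k = Function.extend (Fin.addNatEmb k) v fun _ => x := by
  induction k with
  | zero =>
    funext i
    exact ((Fin.addNatEmb 0).injective.extend_apply v (fun _ => x) i).symm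
  | succ k ih =>
    funext i
    have hk : ∀ j : Fin m, (Fin.addNatEmb (k + 1) j) = (Fin.addNatEmb k j).succ := fun j => rfl
    induction i using Fin.cases with
    | zero =>
      rw [Function.extend_apply']
      · rfl
      · rintro ⟨j, hj⟩
        rw [hk] at hj
        exact Fin.succ_ne_zero _ hj
    | succ i =>
      change consPow x v k i = _
      rw [ih]
      by_cases hi : ∃ j, Fin.addNatEmb k j = i
      · obtain ⟨j, rfl⟩ := hi
        rw [← hk, (Fin.addNatEmb k).injective.extend_apply,
          (Fin.addNatEmb (k + 1)).injective.extend_apply]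
      · rw [Function.extend_apply' _ _ _ hi, Function.extend_apply']
        rintro ⟨j, hj⟩
        exact hi ⟨j, Fin.succ_injective _ ((hk j).symm.trans hj)⟩

theorem prod_norm_consPow {X : Type*} [NormedAddCommGroup X] {m : ℕ} (x : X) (v : Fin m → X) (k : ℕ) :
    ∏ i, ‖consPow x v k i‖ = ‖x‖ ^ k * ∏ i, ‖v i‖ := by
  induction k with
  | zero => simp [consPow]
  | succ k ih =>
    rw [pow_succ', mul_assoc, ← ih]
    exact Fin.prod_univ_succ (n := m + k) fun i => ‖consPow x v (k + 1) i‖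

theorem hasDerivAt_iteratedFDeriv_line {f : E → F} (hf : ContDiff ℝ ∞ f) (n : ℕ) (x δ : E)
    (w : Fin n → E) (s : ℝ) :
    HasDerivAt (fun s : ℝ => iteratedFDeriv ℝ n f (x + s • δ) w)
      (iteratedFDeriv ℝ (n + 1) f (x + s • δ) (Fin.cons δ w)) s := by
  have h1 : HasFDerivAt (iteratedFDeriv ℝ n f)
      (fderiv ℝ (iteratedFDeriv ℝ n f) (x + s • δ)) (x + s • δ) :=
    ((contDiff_iteratedFDeriv hf n).differentiable (by simp) _).hasFDerivAt
  have h2 : HasDerivAt (fun s : ℝ => x + s • δ) δ s := by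
    simpa using ((hasDerivAt_id s).smul_const δ).const_add x
  have h3 := (ContinuousMultilinearMap.apply ℝ (fun _ : Fin n => E) F w).hasFDerivAt.comp_hasDerivAt
    s (h1.comp_hasDerivAt s h2)
  convert! h3 using 1

theorem iteratedDeriv_iteratedFDeriv_line {f : E → F} (hf : ContDiff ℝ ∞ f) {m : ℕ} (x δ : E)
    (v : Fin m → E) (k : ℕ) :
    iteratedDeriv k (fun s : ℝ => iteratedFDeriv ℝ m f (x + s • δ) v) =
      fun s : ℝ => iteratedFDeriv ℝ (m + k) f (x + s • δ) (consPow δ v k) := by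
  induction k with
  | zero => rw [iteratedDeriv_zero]; rfl
  | succ k ih =>
    rw [iteratedDeriv_succ, ih]
    funext s
    exact (hasDerivAt_iteratedFDeriv_line hf (m + k) x δ (consPow δ v k) s).deriv

/-- Taylor's theorem for a derivative of a smooth map. -/
theorem norm_iteratedFDeriv_sub_taylor_le {f : E → F} (hf : ContDiff ℝ ∞ f) (m N : ℕ) (x : E) :
    ∃ C r : ℝ, 0 < r ∧ ∀ (δ : E) (v : Fin m → E), ‖δ‖ < r →
      ‖iteratedFDeriv ℝ m f (x + δ) v - ∑ k ∈ Finset.range (N + 1),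
        (k.factorial : ℝ)⁻¹ • iteratedFDeriv ℝ (m + k) f x (consPow δ v k)‖ ≤
      C * (‖δ‖ ^ (N + 1) * ∏ i, ‖v i‖) := by
  have hc : ContinuousAt (iteratedFDeriv ℝ (m + (N + 1)) f) x :=
    (contDiff_iteratedFDeriv hf _).continuous.continuousAt
  obtain ⟨r, hr, hball⟩ := Metric.continuousAt_iff.1 hc 1 one_pos
  -- By continuity `M` bounds the derivative of order `m + N + 1` on the ball of radius `r`.
  -- Taylor's theorem is applied on `[0, 1]` to the restriction to the segment from `x` to `x + δ`;
  -- its remainder carries the factor `1 / N!`.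
  set M := ‖iteratedFDeriv ℝ (m + (N + 1)) f x‖ + 1 with hM
  refine ⟨M / (N.factorial : ℝ), r, hr, fun δ v hδ => ?_⟩
  set ψ : ℝ → F := fun s => iteratedFDeriv ℝ m f (x + s • δ) v with hψ
  have hsm : ContDiff ℝ ∞ ψ :=
    (ContinuousMultilinearMap.apply ℝ (fun _ : Fin m => E) F v).contDiff.comp
      ((contDiff_iteratedFDeriv hf m).comp (contDiff_const.add (contDiff_id.smul contDiff_const)))
  have hw : ∀ k, ∀ s ∈ Set.Icc (0 : ℝ) 1, iteratedDerivWithin k ψ (Set.Icc 0 1) s =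
      iteratedFDeriv ℝ (m + k) f (x + s • δ) (consPow δ v k) := by
    intro k s hs
    rw [iteratedDerivWithin_eq_iteratedDeriv (uniqueDiffOn_Icc one_pos)
      ((hsm.of_le (by exact_mod_cast le_top)).contDiffAt) hs,
      iteratedDeriv_iteratedFDeriv_line hf]
  have hb := taylor_mean_remainder_bound (f := ψ) (a := 0) (b := 1) (x := 1) (n := N)
    (C := M * (‖δ‖ ^ (N + 1) * ∏ i, ‖v i‖)) zero_le_one
    (hsm.of_le (by exact_mod_cast le_top)).contDiffOn (by simp) (by
      intro s hs
      rw [hw _ _ hs, ← prod_norm_consPow]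
      refine (ContinuousMultilinearMap.le_opNorm _ _).trans ?_
      gcongr
      have hs' : dist (x + s • δ) x < r := by
        rw [dist_eq_norm, add_sub_cancel_left, norm_smul, Real.norm_of_nonneg hs.1]
        exact (mul_le_of_le_one_left (norm_nonneg _) hs.2).trans_lt hδ
      have := hball hs'
      rw [dist_eq_norm] at this
      have h2 := norm_sub_norm_le (iteratedFDeriv ℝ (m + (N + 1)) f (x + s • δ))
        (iteratedFDeriv ℝ (m + (N + 1)) f x)
      linarith)
  have h1 : ψ 1 = iteratedFDeriv ℝ m f (x + δ) v := by simp [hψ]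
  have h2 : taylorWithinEval ψ N (Set.Icc 0 1) 0 1 = ∑ k ∈ Finset.range (N + 1),
      (k.factorial : ℝ)⁻¹ • iteratedFDeriv ℝ (m + k) f x (consPow δ v k) := by
    rw [taylor_within_apply]
    refine Finset.sum_congr rfl fun k _ => ?_
    rw [hw k 0 (by simp)]
    simp
  rw [h1, h2] at hb
  refine hb.trans (le_of_eq ?_)
  simp
  ring

theorem isBigO_iteratedFDeriv_sub_taylor {f : E → F} (hf : ContDiff ℝ ∞ f) {m : ℕ} (N : ℕ) (x : E)
    {δ : ℝ → E} {v : ℝ → Fin m → E} (hδ : δ =O[𝓝 0] fun h => h)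
    (hv : ∀ i, (fun h => v h i) =O[𝓝 0] fun _ => (1 : ℝ)) :
    (fun h => iteratedFDeriv ℝ m f (x + δ h) (v h) - ∑ k ∈ Finset.range (N + 1),
      (k.factorial : ℝ)⁻¹ • iteratedFDeriv ℝ (m + k) f x (consPow (δ h) (v h) k)) =O[𝓝 0]
      fun h : ℝ => h ^ (N + 1) := by
  obtain ⟨C, r, hr, hC⟩ := norm_iteratedFDeriv_sub_taylor_le hf m N x
  have h0 : Tendsto δ (𝓝 0) (𝓝 0) := hδ.trans_tendsto tendsto_id
  have h1 : ∀ᶠ h in 𝓝 (0 : ℝ), ‖δ h‖ < r := by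
    simpa using h0.norm.eventually_lt_const (by simpa using hr)
  have h2 : (fun h => ‖δ h‖ ^ (N + 1) * ∏ i, ‖v h i‖) =O[𝓝 0] fun h : ℝ => h ^ (N + 1) := by
    have h3 : (fun h => ∏ i, ‖v h i‖) =O[𝓝 0] fun _ : ℝ => (1 : ℝ) := by
      have := IsBigO.finsetProd (s := Finset.univ) fun i _ => (hv i).norm_left
      simpa using this
    simpa using (hδ.norm_left.pow (N + 1)).mul h3
  refine (IsBigO.of_bound C ?_).trans h2
  filter_upwards [h1] with h hh
  rw [Real.norm_of_nonneg (by positivity)]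
  exact hC (δ h) (v h) hh

/-- Exchanging the arguments one at a time gives terms with one factor `v - w` and all other factors
bounded. -/
theorem isBigO_multilinear_sub {m : ℕ} {B : ℝ → E [×m]→L[ℝ] F} {v w : ℝ → Fin m → E} {p : ℝ → ℝ}
    (hB : B =O[𝓝 0] fun _ => (1 : ℝ)) (hv : ∀ i, (fun h => v h i) =O[𝓝 0] fun _ => (1 : ℝ))
    (hw : ∀ i, (fun h => w h i) =O[𝓝 0] fun _ => (1 : ℝ))
    (hvw : ∀ i, (fun h => v h i - w h i) =O[𝓝 0] p) :
    (fun h => B h (v h) - B h (w h)) =O[𝓝 0] p := by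
  have h1 : (fun h => ‖B h‖ * ∑ i, ∏ j, if j = i then ‖v h i - w h i‖
      else max ‖v h j‖ ‖w h j‖) =O[𝓝 0] p := by
    have : (fun h => ∑ i, ∏ j, if j = i then ‖v h i - w h i‖ else max ‖v h j‖ ‖w h j‖)
        =O[𝓝 0] p := by
      refine IsBigO.fun_sum fun i _ => ?_
      have h2 := IsBigO.finsetProd (s := Finset.univ) (l := 𝓝 (0 : ℝ))
        (f := fun j h => if j = i then ‖v h i - w h i‖ else max ‖v h j‖ ‖w h j‖)
        (g := fun j h => if j = i then p h else 1) (by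
          intro j _
          by_cases hj : j = i
          · simpa [hj] using (hvw i).norm_left
          · simp only [hj, if_false]
            refine (IsBigO.of_bound 1 (Eventually.of_forall fun h => ?_)).trans
              ((hv j).norm_left.add (hw j).norm_left)
            rw [one_mul, Real.norm_of_nonneg (by positivity), Real.norm_of_nonneg (by positivity)]
            exact max_le_add_of_nonneg (norm_nonneg _) (norm_nonneg _))
      simpa using h2
    simpa using hB.norm_left.mul this
  refine (IsBigO.of_bound 1 (Eventually.of_forall fun h => ?_)).trans h1
  rw [one_mul]
  exact ((B h).norm_image_sub_le' (v h) (w h)).trans (Real.le_norm_self _)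

theorem isBigO_sum_pow_smul {ι : Type*} (s : Finset ι) (e : ι → ℕ) (T : ι → F) (n : ℕ)
    (hn : ∀ i ∈ s, n ≤ e i) :
    (fun h : ℝ => ∑ i ∈ s, h ^ e i • T i) =O[𝓝 0] fun h => h ^ n := by
  refine IsBigO.fun_sum fun i hi => ?_
  have h1 : (fun h : ℝ => h ^ e i) =O[𝓝 0] fun h => h ^ n := by
    rcases (hn i hi).eq_or_lt with h | h
    · rw [h]
    · exact (isLittleO_pow_pow h).isBigO
  simpa using h1.smul (isBigO_refl (fun _ : ℝ => T i) (𝓝 0)) |>.trans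
    ((isBigO_refl _ _).smul (isBigO_const_const (T i) (one_ne_zero (α := ℝ)) (𝓝 (0 : ℝ))))

theorem isBigO_sum_sub_sum_filter {ι : Type*} (s : Finset ι) (e : ι → ℕ) (T : ι → F) (N : ℕ) :
    (fun h : ℝ => ∑ i ∈ s, h ^ e i • T i - ∑ i ∈ s.filter (fun i => e i ≤ N), h ^ e i • T i)
      =O[𝓝 0] fun h => h ^ (N + 1) := by
  have : ∀ h : ℝ, ∑ i ∈ s, h ^ e i • T i - ∑ i ∈ s.filter (fun i => e i ≤ N), h ^ e i • T i =
      ∑ i ∈ s.filter (fun i => ¬ e i ≤ N), h ^ e i • T i := fun h => by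
    rw [sub_eq_iff_eq_add', Finset.sum_filter_add_sum_filter_not]
  simp only [this]
  exact isBigO_sum_pow_smul _ _ _ _ fun i hi => by
    have := (Finset.mem_filter.1 hi).2
    omega

/-- Uniqueness of asymptotic expansions: the first nonzero term would be of exact order `h^n`, while
everything else is `O(h^(n+1))`. This turns estimates into identities of coefficients. -/
theorem eq_zero_of_isBigO {c : ℕ → F} {N : ℕ}
    (h : (fun h : ℝ => ∑ n ∈ Finset.range (N + 1), h ^ n • c n) =O[𝓝 0] fun h => h ^ (N + 1)) :
    ∀ n ≤ N, c n = 0 := by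
  intro n
  induction n using Nat.strong_induction_on with
  | _ n ih =>
    intro hn
    have h1 : (fun h : ℝ => h ^ n • c n) =O[𝓝 0] fun h => h ^ (n + 1) := by
      have h2 : ∀ x : ℝ, x ^ n • c n = ∑ k ∈ Finset.range (N + 1), x ^ k • c k -
          ∑ k ∈ Finset.Ioc n N, x ^ k • c k := by
        intro x
        have hs : ∑ k ∈ Finset.range (N + 1), x ^ k • c k =
            ∑ k ∈ Finset.Icc n N, x ^ k • c k := by
          symm
          refine Finset.sum_subset (fun k hk => ?_) fun k hk hk' => ?_
          · simp at hk ⊢; omega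
          · simp at hk hk'
            rw [ih k (by omega) (by omega), smul_zero]
        rw [hs, ← Finset.Ioc_insert_left hn, Finset.sum_insert (by simp)]
        simp
      simp only [h2]
      refine (h.trans ?_).sub (isBigO_sum_pow_smul _ _ _ _ fun i hi => ?_)
      · rcases hn.eq_or_lt with h | h
        · rw [h]; exact isBigO_refl _ _
        · exact (isLittleO_pow_pow (by omega)).isBigO
      · simp at hi; omega
    have h2 : (fun h : ℝ => h ^ n • c n) =o[𝓝 0] fun h => h ^ n :=
      h1.trans_isLittleO (isLittleO_pow_pow (by omega))
    by_contra hc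
    -- A nonzero `x` allows `x ^ n` to be cancelled, and the constant `‖c n‖ / 2` then gives `‖c n‖
    -- ≤ ‖c n‖ / 2`.
    have h3 := (h2.mono (nhdsWithin_le_nhds (s := {0}ᶜ))).def (half_pos (norm_pos_iff.2 hc))
    obtain ⟨x, hx, hx0⟩ := (h3.and self_mem_nhdsWithin).exists
    rw [norm_smul, mul_comm] at hx
    have h4 : 0 < ‖x ^ n‖ := norm_pos_iff.2 (pow_ne_zero _ hx0)
    have h5 := le_of_mul_le_mul_right hx h4
    have h6 := norm_pos_iff.2 hc
    linarith

end Analysis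

end BSeries

/-! ### Formal substitution as an asymptotic expansion. -/

namespace BSeries

open Asymptotics Filter Topology

variable {E F : Type*} [NormedAddCommGroup E] [NormedSpace ℝ E]
  [NormedAddCommGroup F] [NormedSpace ℝ F]

theorem sum_filter_pow_smul {ι : Type*} (s : Finset ι) (e : ι → ℕ) (T : ι → F) (N : ℕ) (h : ℝ) :
    ∑ i ∈ s.filter (fun i => e i ≤ N), h ^ e i • T i =
      ∑ n ∈ Finset.range (N + 1), h ^ n • ∑ i ∈ s.filter (fun i => e i = n), T i := by
  rw [← Finset.sum_fiberwise_of_maps_to (t := Finset.range (N + 1)) (g := e)]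
  swap
  · intro i hi
    have := (Finset.mem_filter.1 hi).2
    simp; omega
  refine Finset.sum_congr rfl fun n hn => ?_
  have hn : n < N + 1 := Finset.mem_range.1 hn
  rw [Finset.smul_sum, Finset.filter_filter]
  refine Finset.sum_congr ?_ fun i hi => by rw [(Finset.mem_filter.1 hi).2]
  ext i
  simp only [Finset.mem_filter]
  refine and_congr_right fun _ => ⟨fun h => h.2, fun h => ⟨by omega, h⟩⟩

/-- A composition of `n` is a tuple of positive integers with sum `n`; its length and entries are at
most `N`. The tuples thus come from one index set for all `n ≤ N`, the one that the multilinear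
expansion produces. -/
theorem evalAt_eq_sum (g : E → E) (Y : FormalSeries E) {n N : ℕ} (hn : n ≤ N) :
    evalAt g Y n = ∑ p ∈ ((Finset.range (N + 1)).sigma fun k =>
        Fintype.piFinset fun _ : Fin k => Finset.Icc 1 N).filter (fun p => ∑ i, p.2 i = n),
      (p.1.factorial : ℝ)⁻¹ • iteratedFDeriv ℝ p.1 g (Y 0) fun i => Y (p.2 i) := by
  refine Finset.sum_bij (fun c _ => ⟨c.length, c.blocksFun⟩) ?_ ?_ ?_ fun _ _ => rfl
  · intro c _
    simp only [Finset.mem_filter, Finset.mem_sigma, Finset.mem_range, Fintype.mem_piFinset,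
      Finset.mem_Icc]
    exact ⟨⟨by have := c.length_le; omega,
      fun i => ⟨c.one_le_blocksFun i, (c.blocksFun_le i).trans hn⟩⟩, c.sum_blocksFun⟩
  · intro c _ c' _ h
    refine Composition.ext ?_
    rw [← c.ofFn_blocksFun, ← c'.ofFn_blocksFun]
    exact List.ofFn_inj'.2 h
  · rintro ⟨k, κ⟩ hp
    simp only [Finset.mem_filter, Finset.mem_sigma, Finset.mem_range, Fintype.mem_piFinset,
      Finset.mem_Icc] at hp
    refine ⟨⟨List.ofFn κ, ?_, ?_⟩, Finset.mem_univ _, ?_⟩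
    · intro i hi
      obtain ⟨j, rfl⟩ := List.mem_ofFn.1 hi
      exact (hp.1.2 j).1
    · rw [List.sum_ofFn, hp.2]
    · exact List.ofFn_inj'.1 (Composition.ofFn_blocksFun _)

theorem iteratedFDeriv_consPow_elim0 (g : E → F) (x y : E) (v : Fin 0 → E) (k : ℕ) :
    iteratedFDeriv ℝ (0 + k) g x (consPow y v k) = iteratedFDeriv ℝ k g x fun _ => y := by
  have h1 : consPow y v k = fun _ => y := by
    rw [consPow_eq_extend]
    funext i
    exact Function.extend_apply' _ _ _ fun ⟨j, _⟩ => j.elim0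
  have h2 : ∀ l, l = k → (iteratedFDeriv ℝ l g x fun _ => y) = iteratedFDeriv ℝ k g x fun _ => y := by
    rintro l rfl
    rfl
  rw [h1]
  exact h2 _ (zero_add k)

/-- The series `evalAt g Y` is the asymptotic expansion of `g` along the partial sums of `Y`. -/
theorem isBigO_sub_evalAt {g : E → E} (hg : ContDiff ℝ ∞ g) (Y : FormalSeries E) (N : ℕ) :
    (fun h : ℝ => g (Y 0 + ∑ j ∈ Finset.Icc 1 N, h ^ j • Y j) -
      ∑ n ∈ Finset.range (N + 1), h ^ n • evalAt g Y n) =O[𝓝 0] fun h => h ^ (N + 1) := by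
  classical
  have hδ : (fun h : ℝ => ∑ j ∈ Finset.Icc 1 N, h ^ j • Y j) =O[𝓝 0] fun h => h := by
    simpa using isBigO_sum_pow_smul (Finset.Icc 1 N) id Y 1 fun i hi => (Finset.mem_Icc.1 hi).1
  have h1 := isBigO_iteratedFDeriv_sub_taylor hg (m := 0) N (Y 0) hδ
    (v := fun _ => Fin.elim0) fun i => i.elim0
  simp only [iteratedFDeriv_consPow_elim0, iteratedFDeriv_zero_apply] at h1
  set P := (Finset.range (N + 1)).sigma fun k => Fintype.piFinset fun _ : Fin k => Finset.Icc 1 N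
    with hP
  set T : (Σ k, Fin k → ℕ) → E := fun p =>
    (p.1.factorial : ℝ)⁻¹ • iteratedFDeriv ℝ p.1 g (Y 0) fun i => Y (p.2 i) with hT
  have h2 : ∀ h : ℝ, ∑ k ∈ Finset.range (N + 1), (k.factorial : ℝ)⁻¹ •
      iteratedFDeriv ℝ k g (Y 0) (fun _ => ∑ j ∈ Finset.Icc 1 N, h ^ j • Y j) =
      ∑ p ∈ P, h ^ (∑ i, p.2 i) • T p := by
    intro h
    rw [hP, Finset.sum_sigma]
    refine Finset.sum_congr rfl fun k _ => ?_
    rw [(iteratedFDeriv ℝ k g (Y 0)).map_sum_finset, Finset.smul_sum]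
    refine Finset.sum_congr rfl fun κ _ => ?_
    rw [(iteratedFDeriv ℝ k g (Y 0)).map_smul_univ (fun i => h ^ κ i) fun i => Y (κ i),
      Finset.prod_pow_eq_pow_sum, smul_comm]
  -- The expanded Taylor polynomial also has terms of degree above `N`, which go into the error.
  have h3 := isBigO_sum_sub_sum_filter P (fun p => ∑ i, p.2 i) T N
  have h4 : ∀ h : ℝ, ∑ p ∈ P.filter (fun p => ∑ i, p.2 i ≤ N), h ^ (∑ i, p.2 i) • T p =
      ∑ n ∈ Finset.range (N + 1), h ^ n • evalAt g Y n := by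
    intro h
    rw [sum_filter_pow_smul P (fun p => ∑ i, p.2 i) T N h]
    refine Finset.sum_congr rfl fun n hn => ?_
    rw [evalAt_eq_sum g Y (Nat.lt_succ_iff.1 (Finset.mem_range.1 hn))]
  simp only [h4] at h3
  simp only [h2] at h1
  simpa using h1.add h3

/-! ### Expansion of elementary differentials over plane trees. -/

/-- The partial sum of order `N` of the series `∑ h^|t| φ(t) F(t)(y) / w(t)` over plane trees. -/
noncomputable def planeSum (f : E → E) (y : E) (N : ℕ) (φ : PTree → ℝ) (h : ℝ) : E :=
  ∑ t ∈ PTree.orderLE N, h ^ t.order • (φ t / t.weight) • t.elemDiff f y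

theorem PTree.order_pos (t : PTree) : 0 < t.order := by
  obtain ⟨n, c⟩ := t
  rw [PTree.order_node]
  omega

theorem isBigO_planeSum (f : E → E) (y : E) (N : ℕ) (φ : PTree → ℝ) :
    planeSum f y N φ =O[𝓝 0] fun h => h := by
  simpa using! isBigO_sum_pow_smul (PTree.orderLE N) PTree.order
    (fun t => (φ t / t.weight) • t.elemDiff f y) 1 fun t _ => t.order_pos

/-- Two injections of `Fin m` into `Fin (m + k)` differ by a permutation of the target, and the
derivative is symmetric. -/
theorem iteratedFDeriv_extend_eq_consPow {f : E → E} (hf : ContDiff ℝ ∞ f) (y x : E) {m : ℕ}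
    (v : Fin m → E) (k : ℕ) (ι : Fin m ↪ Fin (m + k)) :
    iteratedFDeriv ℝ (m + k) f y (Function.extend ι v fun _ => x) =
      iteratedFDeriv ℝ (m + k) f y (consPow x v k) := by
  obtain ⟨ε, hε⟩ := Equiv.Perm.exists_extending_pair ι (Fin.addNatEmb k) ι.injective
    (Fin.addNatEmb k).injective
  rw [← PTree.iteratedFDeriv_comp_perm_of_smooth hf y (consPow x v k) ε, consPow_eq_extend]
  congr 1
  funext j
  by_cases hj : ∃ i, ι i = j
  · obtain ⟨i, rfl⟩ := hj
    rw [Function.comp, hε, ι.injective.extend_apply, (Fin.addNatEmb k).injective.extend_apply]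
  · rw [Function.comp, Function.extend_apply' _ _ _ hj, Function.extend_apply']
    rintro ⟨i, hi⟩
    exact hj ⟨i, ε.injective ((hε i).trans hi)⟩

/-- A choice of one tree for each argument is a plane tree with these branches, and the derivative
of `f` at their elementary differentials is by definition that of the new tree. -/
theorem iteratedFDeriv_planeSum (f : E → E) (y : E) (N n : ℕ) (φ : Fin n → PTree → ℝ) (h : ℝ) :
    iteratedFDeriv ℝ n f y (fun j => planeSum f y N (φ j) h) =
      ∑ d ∈ Fintype.piFinset fun _ : Fin n => PTree.orderLE N,
        h ^ (∑ j, (d j).order) • ((∏ j, φ j (d j)) / ∏ j, ((d j).weight : ℝ)) •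
          (PTree.node n d).elemDiff f y := by
  classical
  simp only [planeSum]
  rw [(iteratedFDeriv ℝ n f y).map_sum_finset]
  refine Finset.sum_congr rfl fun d _ => ?_
  rw [(iteratedFDeriv ℝ n f y).map_smul_univ (fun j => h ^ (d j).order)
    fun j => (φ j (d j) / (d j).weight) • (d j).elemDiff f y,
    (iteratedFDeriv ℝ n f y).map_smul_univ (fun j => φ j (d j) / (d j).weight)
    fun j => (d j).elemDiff f y, Finset.prod_pow_eq_pow_sum, Finset.prod_div_distrib]
  rfl

/-- The heart of the induction. The left side is averaged over the `(m + k)! / k!` positions of the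
special arguments; the sum over positions is `embSum` by `embSum_node`, and the remaining `1 / (m +
k)!` is the share of the root in `1 / weight`. -/
theorem inv_factorial_smul_iteratedFDeriv_consPow {f : E → E} (hf : ContDiff ℝ ∞ f) (y : E)
    (a : Option RTree → ℝ) (N : ℕ) {m : ℕ} (c : Fin m → PTree) (k : ℕ) (h : ℝ) :
    (k.factorial : ℝ)⁻¹ • iteratedFDeriv ℝ (m + k) f y
      (consPow (planeSum f y N (fun t => a (some t.toRTree)) h)
        (fun i => planeSum f y N (PTree.embSum a (c i)) h) k) =
      ∑ d ∈ Fintype.piFinset fun _ : Fin (m + k) => PTree.orderLE N,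
        h ^ (∑ j, (d j).order) •
          (PTree.embSum a (PTree.node m c) (PTree.node (m + k) d) /
            (PTree.node (m + k) d).weight) • (PTree.node (m + k) d).elemDiff f y := by
  set X := iteratedFDeriv ℝ (m + k) f y
      (consPow (planeSum f y N (fun t => a (some t.toRTree)) h)
        (fun i => planeSum f y N (PTree.embSum a (c i)) h) k) with hX
  have h1 : ∀ ι : Fin m ↪ Fin (m + k), X =
      ∑ d ∈ Fintype.piFinset fun _ : Fin (m + k) => PTree.orderLE N,
        h ^ (∑ j, (d j).order) • ((∏ j, Function.extend ι (fun i => PTree.embSum a (c i))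
          (fun _ t => a (some t.toRTree)) j (d j)) / ∏ j, ((d j).weight : ℝ)) •
          (PTree.node (m + k) d).elemDiff f y := by
    intro ι
    rw [← iteratedFDeriv_planeSum, hX, ← iteratedFDeriv_extend_eq_consPow hf _ _ _ _ ι]
    congr 1
    funext j
    by_cases hj : ∃ i, ι i = j
    · obtain ⟨i, rfl⟩ := hj
      rw [ι.injective.extend_apply, ι.injective.extend_apply]
    · rw [Function.extend_apply' _ _ _ hj, Function.extend_apply' _ _ _ hj]
  have h2 : ((m + k).descFactorial m : ℝ) • X =
      ∑ d ∈ Fintype.piFinset fun _ : Fin (m + k) => PTree.orderLE N,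
        h ^ (∑ j, (d j).order) • (PTree.embSum a (PTree.node m c) (PTree.node (m + k) d) /
          ∏ j, ((d j).weight : ℝ)) • (PTree.node (m + k) d).elemDiff f y := by
    have : ((m + k).descFactorial m : ℝ) • X = ∑ _ι : Fin m ↪ Fin (m + k), X := by
      rw [Finset.sum_const, Finset.card_univ, Fintype.card_embedding_eq, Fintype.card_fin,
        Fintype.card_fin, Nat.cast_smul_eq_nsmul]
    rw [this, Finset.sum_congr rfl fun ι _ => h1 ι, Finset.sum_comm]
    refine Finset.sum_congr rfl fun d _ => ?_
    rw [← Finset.smul_sum, ← Finset.sum_smul, ← Finset.sum_div, PTree.embSum_node]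
  have h3 : (k.factorial : ℝ)⁻¹ = ((m + k).factorial : ℝ)⁻¹ * (m + k).descFactorial m := by
    have h4 := Nat.factorial_mul_descFactorial (Nat.le_add_right m k)
    rw [Nat.add_sub_cancel_left] at h4
    have h5 : ((m + k).factorial : ℝ) ≠ 0 := Nat.cast_ne_zero.2 (Nat.factorial_ne_zero _)
    have h6 : (k.factorial : ℝ) ≠ 0 := Nat.cast_ne_zero.2 (Nat.factorial_ne_zero _)
    field_simp
    exact_mod_cast h4.symm
  rw [h3, mul_smul, h2, Finset.smul_sum]
  refine Finset.sum_congr rfl fun d _ => ?_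
  rw [smul_comm]
  congr 1
  rw [smul_smul, PTree.weight]
  congr 1
  push_cast
  field_simp

theorem PTree.embSum_node_of_lt (a : Option RTree → ℝ) {m n : ℕ} (c : Fin m → PTree)
    (d : Fin n → PTree) (h : n < m) : embSum a (node m c) (node n d) = 0 := by
  have : IsEmpty (Fin m ↪ Fin n) :=
    Function.Embedding.isEmpty_of_card_lt (by simpa using h)
  rw [embSum_node, Finset.univ_eq_empty, Finset.sum_empty]

theorem PTree.arity_lt_order {n : ℕ} (c : Fin n → PTree) : n < order (node n c) := by
  have h : n ≤ ∑ i, order (c i) := by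
    simpa using Finset.sum_le_sum (s := Finset.univ) (f := fun _ => 1)
      (g := fun i => order (c i)) fun i _ => (c i).order_pos
  rw [order_node]
  omega

/-- A tree with fewer than `m` branches admits no embedding, so the root has `m + k` branches, where
`k` is the order of the Taylor term. Here `k ≤ N` because the order of a tree exceeds its number of
branches. -/
theorem planeSum_embSum_node_eq (f : E → E) (y : E) (a : Option RTree → ℝ) (N : ℕ) {m : ℕ}
    (c : Fin m → PTree) (h : ℝ) :
    planeSum f y N (PTree.embSum a (PTree.node m c)) h =
      ∑ p ∈ ((Finset.range (N + 1)).sigma fun k =>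
        Fintype.piFinset fun _ : Fin (m + k) => PTree.orderLE N).filter
          (fun p => (PTree.node (m + p.1) p.2).order ≤ N),
        h ^ (PTree.node (m + p.1) p.2).order •
          (PTree.embSum a (PTree.node m c) (PTree.node (m + p.1) p.2) /
            (PTree.node (m + p.1) p.2).weight) • (PTree.node (m + p.1) p.2).elemDiff f y := by
  classical
  have hinj : Function.Injective
      (fun p : Σ k, Fin (m + k) → PTree => PTree.node (m + p.1) p.2) := by
    rintro ⟨k, d⟩ ⟨l, e⟩ hp
    have h1 : m + k = m + l := by injection hp
    obtain rfl : k = l := by omega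
    have h2 : d = e := PTree.node_injective _ hp
    rw [h2]
  rw [← Finset.sum_image (f := fun t => h ^ t.order •
    (PTree.embSum a (PTree.node m c) t / t.weight) • t.elemDiff f y) hinj.injOn]
  symm
  refine Finset.sum_subset ?_ ?_
  · intro t ht
    obtain ⟨p, hp, rfl⟩ := Finset.mem_image.1 ht
    exact PTree.mem_orderLE.2 (Finset.mem_filter.1 hp).2
  · rintro ⟨n, d⟩ ht hnot
    have hd := PTree.mem_orderLE.1 ht
    rcases lt_or_ge n m with hnm | hnm
    · rw [PTree.embSum_node_of_lt a c d hnm, zero_div, zero_smul, smul_zero]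
    · obtain ⟨k, rfl⟩ := Nat.exists_eq_add_of_le hnm
      refine (hnot (Finset.mem_image.2 ⟨⟨k, d⟩, ?_, rfl⟩)).elim
      have := PTree.arity_lt_order d
      simp only [Finset.mem_filter, Finset.mem_sigma, Finset.mem_range, Fintype.mem_piFinset,
        PTree.mem_orderLE]
      exact ⟨⟨by omega, fun i => (PTree.order_branch_lt d i).le.trans hd⟩, hd⟩

/-- The expansion of an elementary differential along a B-series, over plane trees. -/
theorem isBigO_elemDiff_sub_planeSum {f : E → E} (hf : ContDiff ℝ ∞ f) (y : E)
    (a : Option RTree → ℝ) (N : ℕ) : (s : PTree) →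
    (fun h : ℝ => h ^ s.order •
      s.elemDiff f (y + planeSum f y N (fun t => a (some t.toRTree)) h) -
      planeSum f y N (PTree.embSum a s) h) =O[𝓝 0] fun h => h ^ (N + 1)
  | .node m c => by
    have ih : ∀ i, (fun h : ℝ => h ^ (c i).order •
        (c i).elemDiff f (y + planeSum f y N (fun t => a (some t.toRTree)) h) -
        planeSum f y N (PTree.embSum a (c i)) h) =O[𝓝 0] fun h => h ^ (N + 1) := fun i =>
      isBigO_elemDiff_sub_planeSum hf y a N (c i)
    set δ := planeSum f y N (fun t => a (some t.toRTree)) with hδdef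
    have hδ : δ =O[𝓝 0] fun h => h := isBigO_planeSum _ _ _ _
    have hid : (fun h : ℝ => h) =O[𝓝 0] fun _ => (1 : ℝ) :=
      continuous_id.continuousAt.isBigO_one ℝ
    have hpow : (fun h : ℝ => h ^ (N + 1)) =O[𝓝 0] fun _ => (1 : ℝ) := by
      simpa using hid.pow (N + 1)
    have hG : ∀ i, planeSum f y N (PTree.embSum a (c i)) =O[𝓝 0] fun _ => (1 : ℝ) := fun i =>
      (isBigO_planeSum _ _ _ _).trans hid
    have hv : ∀ i, (fun h : ℝ => h ^ (c i).order • (c i).elemDiff f (y + δ h)) =O[𝓝 0]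
        fun _ => (1 : ℝ) := fun i => by
      simpa using ((ih i).trans hpow).add (hG i)
    have hB : (fun h => iteratedFDeriv ℝ m f (y + δ h)) =O[𝓝 0] fun _ => (1 : ℝ) := by
      have h0 : Tendsto (fun h => y + δ h) (𝓝 0) (𝓝 (y + 0)) :=
        tendsto_const_nhds.add (hδ.trans_tendsto tendsto_id)
      exact (((contDiff_iteratedFDeriv hf m).continuous.tendsto _).comp h0).isBigO_one ℝ
    -- The arguments are replaced by their expansions from the induction hypothesis while the
    -- derivative stays at `y + δ h`; only then is the derivative expanded at `y`.
    have h1 := isBigO_multilinear_sub (p := fun h : ℝ => h ^ (N + 1)) hB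
      (v := fun h i => h ^ (c i).order • (c i).elemDiff f (y + δ h))
      (w := fun h i => planeSum f y N (PTree.embSum a (c i)) h) hv hG ih
    have h2 := h1.add (isBigO_iteratedFDeriv_sub_taylor hf N y hδ
      (v := fun h i => planeSum f y N (PTree.embSum a (c i)) h) hG)
    simp only [sub_add_sub_cancel] at h2
    set P := (Finset.range (N + 1)).sigma fun k =>
        Fintype.piFinset fun _ : Fin (m + k) => PTree.orderLE N with hP
    have h3 := isBigO_sum_sub_sum_filter P (fun p => (PTree.node (m + p.1) p.2).order)
      (fun p => (PTree.embSum a (PTree.node m c) (PTree.node (m + p.1) p.2) /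
            (PTree.node (m + p.1) p.2).weight) • (PTree.node (m + p.1) p.2).elemDiff f y) N
    simp only [hP, ← planeSum_embSum_node_eq] at h3
    -- The root contributes one more factor `h`. Boundedness of that factor is enough to keep the
    -- error `O(h^(N+1))`.
    have h4 := hid.smul h2
    simp only [one_smul] at h4
    refine (h4.add h3).congr_left fun h => ?_
    have h5 : h • ∑ k ∈ Finset.range (N + 1), (k.factorial : ℝ)⁻¹ •
        iteratedFDeriv ℝ (m + k) f y (consPow (δ h)
          (fun i => planeSum f y N (PTree.embSum a (c i)) h) k) = ∑ p ∈ P,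
        h ^ (PTree.node (m + p.1) p.2).order •
          (PTree.embSum a (PTree.node m c) (PTree.node (m + p.1) p.2) /
            (PTree.node (m + p.1) p.2).weight) • (PTree.node (m + p.1) p.2).elemDiff f y := by
      rw [hP, Finset.sum_sigma, Finset.smul_sum]
      refine Finset.sum_congr rfl fun k _ => ?_
      rw [inv_factorial_smul_iteratedFDeriv_consPow hf, Finset.smul_sum]
      refine Finset.sum_congr rfl fun d _ => ?_
      rw [smul_smul h, PTree.order_node, pow_add, pow_one]
    have h6 : h ^ (PTree.node m c).order • (PTree.node m c).elemDiff f (y + δ h) =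
        h • iteratedFDeriv ℝ m f (y + δ h)
          fun i => h ^ (c i).order • (c i).elemDiff f (y + δ h) := by
      rw [(iteratedFDeriv ℝ m f (y + δ h)).map_smul_univ (fun i => h ^ (c i).order)
        fun i => (c i).elemDiff f (y + δ h), smul_smul, Finset.prod_pow_eq_pow_sum,
        PTree.order_node, pow_add, pow_one]
      rfl
    rw [smul_sub, h5, h6, sub_add_sub_cancel]

/-! ### Comparison of coefficients and return to rooted trees. -/

theorem bSeries_zero (f : E → E) (hf : ContDiff ℝ ∞ f) (a : Option RTree → ℝ) (ha : a none = 1)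
    (y : E) : bSeries f hf a y 0 = y := by
  have h : RTree.ofOrder 0 = ∅ := by
    refine Finset.eq_empty_of_forall_notMem fun t ht => ?_
    induction t using Quotient.inductionOn with
    | h s => exact s.order_pos.ne' (RTree.mem_ofOrder.1 ht)
  simp [bSeries, treeSeries, h, ha]

open Classical in
theorem bSeries_eq_sum (f : E → E) (hf : ContDiff ℝ ∞ f) (a : Option RTree → ℝ) (y : E)
    {n N : ℕ} (h0 : n ≠ 0) (hn : n ≤ N) :
    bSeries f hf a y n = ∑ t ∈ (PTree.orderLE N).filter (fun t => t.order = n),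
      (a (some t.toRTree) / t.weight) • t.elemDiff f y := by
  have h := PTree.sum_ofOrder_eq (fun t => a (some t) • t.elemDiff f hf y) hn
  simp only [smul_smul] at h
  simp only [bSeries, treeSeries, Pi.add_apply, h0, if_false, zero_add, Set.mem_univ,
    Finset.filter_true, div_eq_inv_mul]
  exact h

theorem planeSum_eq_sum_pow (f : E → E) (y : E) (N : ℕ) (φ : PTree → ℝ) (h : ℝ) :
    planeSum f y N φ h = ∑ n ∈ Finset.range (N + 1), h ^ n •
      ∑ t ∈ (PTree.orderLE N).filter (fun t => t.order = n),
        (φ t / t.weight) • t.elemDiff f y := by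
  rw [← sum_filter_pow_smul, Finset.filter_true_of_mem fun t ht => PTree.mem_orderLE.1 ht]
  rfl

theorem planeSum_eq_sum_bSeries (f : E → E) (hf : ContDiff ℝ ∞ f) (a : Option RTree → ℝ) (y : E)
    (N : ℕ) (h : ℝ) : planeSum f y N (fun t => a (some t.toRTree)) h =
      ∑ n ∈ Finset.Icc 1 N, h ^ n • bSeries f hf a y n := by
  classical
  rw [planeSum_eq_sum_pow]
  symm
  rw [Finset.sum_congr rfl fun n hn => by
    rw [bSeries_eq_sum f hf a y (Nat.one_le_iff_ne_zero.1 (Finset.mem_Icc.1 hn).1)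
      (Finset.mem_Icc.1 hn).2]]
  refine Finset.sum_subset (fun n hn => ?_) fun n hn hn' => ?_
  · simp at hn ⊢; omega
  · obtain rfl : n = 0 := by simp at hn hn'; omega
    rw [Finset.filter_false_of_mem fun t _ => t.order_pos.ne', Finset.sum_empty, smul_zero]

theorem sum_pow_smul_hPowMul (k N : ℕ) (s : FormalSeries E) (h : ℝ) :
    ∑ n ∈ Finset.range (N + 1), h ^ n • hPowMul k s n =
      ∑ n ∈ (Finset.range (N + 1)).filter (fun n => k + n ≤ N), h ^ (k + n) • s n := by
  simp only [hPowMul, smul_ite, smul_zero]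
  rw [← Finset.sum_filter]
  symm
  refine Finset.sum_bij (fun n _ => k + n) ?_ (fun _ _ _ _ h => Nat.add_left_cancel h) ?_ ?_
  · intro n hn
    simp at hn ⊢
    omega
  · intro n hn
    simp at hn
    exact ⟨n - k, by simp; omega, by omega⟩
  · intro n _
    rw [Nat.add_sub_cancel_left]

/-- The function `h^|s| F(s)(y + δ(h))`, with the B-series truncated at order `n`, has two
expansions modulo `O(h^(n+1))`, by formal substitution and over plane trees. Their coefficients
agree. -/
theorem hPowMul_evalAt_elemDiff {f : E → E} (hf : ContDiff ℝ ∞ f) (y : E)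
    (a : Option RTree → ℝ) (ha : a none = 1) (s : PTree) (n : ℕ) :
    hPowMul s.order (evalAt (s.elemDiff f) (bSeries f hf a y)) n =
      ∑ t ∈ (PTree.orderLE n).filter (fun t => t.order = n),
        (PTree.embSum a s t / t.weight) • t.elemDiff f y := by
  set Y := bSeries f hf a y with hY
  have h1 := isBigO_elemDiff_sub_planeSum hf y a n s
  have h2 := isBigO_sub_evalAt (PTree.contDiff_elemDiff hf s) Y n
  have hid : (fun h : ℝ => h ^ s.order) =O[𝓝 0] fun _ => (1 : ℝ) :=
    (continuous_pow s.order).continuousAt.isBigO_one ℝ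
  have h3 := hid.smul h2
  -- Multiplication by `h^|s|` pushes some terms beyond degree `n`; they go into the error.
  have h4 := isBigO_sum_sub_sum_filter (Finset.range (n + 1)) (fun j => s.order + j)
    (evalAt (s.elemDiff f) Y) n
  simp only [one_smul] at h3
  have h5 := h1.sub (h3.add h4)
  refine sub_eq_zero.1 (eq_zero_of_isBigO (N := n) (c := fun j =>
    hPowMul s.order (evalAt (s.elemDiff f) Y) j -
      ∑ t ∈ (PTree.orderLE n).filter (fun t => t.order = j),
        (PTree.embSum a s t / t.weight) • t.elemDiff f y) (h5.congr_left fun h => ?_) n le_rfl)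
  simp only [smul_sub, Finset.sum_sub_distrib]
  rw [← planeSum_eq_sum_pow, sum_pow_smul_hPowMul, hY, bSeries_zero f hf a ha,
    ← planeSum_eq_sum_bSeries, ← hY, Finset.smul_sum]
  simp only [pow_add, smul_smul]
  abel

theorem forestMap_prune_eq_zero (a : Option RTree → ℝ) {s t : RTree} (h : ¬ s ≤ t) :
    forestMap a (t.prune s) = 0 := by
  induction s using Quotient.inductionOn with
  | h s =>
    induction t using Quotient.inductionOn with
    | h t =>
      have : PTree.copies s t = ∅ := by
        refine Finset.eq_empty_of_forall_notMem fun S hS => h ?_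
        obtain ⟨π, -⟩ := PTree.mem_copies.1 hS
        exact ⟨π.1, π.2⟩
      change forestMap a (PTree.prune t s) = 0
      rw [PTree.prune, this, Finset.sum_empty, map_zero]

end BSeries

open BSeries in
theorem lemma1 {d : ℕ} (f : EuclideanSpace ℝ (Fin d) → EuclideanSpace ℝ (Fin d))
    (hf : ContDiff ℝ ∞ f) (y₀ : EuclideanSpace ℝ (Fin d))
    (a : Option RTree → ℝ) (ha : a none = 1) (t' : RTree) :
    (1 / (t'.symmetry : ℝ)) • hPowMul t'.order (evalAt (t'.elemDiff f hf) (bSeries f hf a y₀)) =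
      treeSeries {t | t' ≤ t} fun t =>
        (forestMap a (t.prune t') / t.symmetry) • t.elemDiff f hf y₀ := by
  classical
  obtain ⟨s, rfl⟩ : ∃ s, PTree.toRTree s = t' := Quotient.exists_rep t'
  funext n
  have h1 := hPowMul_evalAt_elemDiff hf y₀ a ha s n
  have h2 := PTree.sum_ofOrder_eq
    (fun t => forestMap a (t.prune s.toRTree) • t.elemDiff f hf y₀) (le_refl n)
  have h3 : treeSeries {t | s.toRTree ≤ t} (fun t =>
      (forestMap a (t.prune s.toRTree) / t.symmetry) • t.elemDiff f hf y₀) n =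
      ∑ t ∈ RTree.ofOrder n, (t.symmetry : ℝ)⁻¹ •
        forestMap a (t.prune s.toRTree) • t.elemDiff f hf y₀ := by
    rw [treeSeries, Finset.sum_filter]
    -- Trees that do not contain `t'` have zero pruning, so the sum may run over all trees of order
    -- `n`.
    refine Finset.sum_congr rfl fun t _ => ?_
    split_ifs with h
    · rw [smul_smul, div_eq_inv_mul]
    · rw [forestMap_prune_eq_zero a h, zero_smul, smul_zero]
  rw [h3, h2]
  change (1 / (s.symmetry : ℝ)) •
    hPowMul s.order (evalAt (s.elemDiff f) (bSeries f hf a y₀)) n = _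
  rw [h1, Finset.smul_sum]
  refine Finset.sum_congr (by congr!) fun t _ => ?_
  have hs : (s.symmetry : ℝ) ≠ 0 := Nat.cast_ne_zero.2 s.symmetry_pos.ne'
  -- The factor `σ(s)` from counting embeddings cancels `1 / σ(s)`.
  rw [← PTree.symmetry_mul_forestMap_prune, smul_smul, smul_smul]
  congr 1
  change _ = (t.weight : ℝ)⁻¹ * forestMap a (PTree.prune t s)
  field_simp
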